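/- **Setting.** Let $(M,d)$ be a complete separable metric space with a fixed base point $o\in M$. For $x\in M$ put $\xi_x(y)=d(x,o)-d(x,y)$, and let $\widehat M$ be the closure of $\{\xi_x : x\in M\}$ in the topology of uniform convergence on compact sets; elements of $\widehat M$ are called horofunctions. A sequence $(x_n)_{n\in\mathbb Z}$ of random points of $M$ is called distance stationary if $(d(x_m,x_n))_{m,n\in\mathbb Z}$ and $(d(x_{m+1},x_{n+1}))_{m,n\in\mathbb Z}$ have the same distribution. **Theorem (Furstenberg type formula for distance stationary sequences).** Let $(x_n)_{n\in\mathbb Z}$ be a distance stationary sequence in $M$ with $\mathbb E[d(x_0,x_1)]<+\infty$, and suppose that there is a random variable $u$, defined on the same probability space, which is uniformly distributed on $[0,1]$ and independent of $(x_n)_{n\in\mathbb Z}$. Then the limit $\ell=\lim_{n\to+\infty}\frac1n d(x_0,x_n)$ (the linear drift) exists almost surely and is integrable, and the following holds. 1. The sequence of random probability measures on $\widehat M$ defined by $\mu_n=\frac1n\sum_{i=1}^n\delta_{\xi_{x_{-i}}}$, $n\ge1$, has a subsequence $(\mu_{n_j})_{j\ge1}$ which is almost surely Cesàro convergent to a random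 probability measure $\mu$ on $\widehat M$; that is, almost surely $\frac1k\sum_{j=1}^k\mu_{n_j}\to\mu$ weakly as $k\to+\infty$. 2. For every such subsequence and limit $\mu$ there exists a random horofunction $\xi$ which is measurable with respect to $\sigma(u,\mu)$ and whose conditional distribution given $(x_n)_{n\in\mathbb Z}$ is $\mu$. 3. For every $\mu$ as in 1 and every $\xi$ as in 2, the sequence of increments $(\xi(x_n)-\xi(x_{n+1}))_{n\in\mathbb Z}$ is stationary and integrable, and its Birkhoff limit equals $\ell$: almost surely $$\lim_{n\to+\infty}\frac1n\sum_{i=0}^{n-1}\bigl(\xi(x_i)-\xi(x_{i+1})\bigr)=\ell .$$ In particular $\mathbb E[\ell]=\mathbb E[\xi(x_0)-\xi(x_1)]$. -/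

import Mathlib

open MeasureTheory ProbabilityTheory Filter Topology
open scoped ENNReal

/-- The horofunction `ξ_x(y) = d(x, o) - d(x, y)` of the point `x`, normalized at the base point
`o`, as a continuous function on `M`. -/
def pointHorofunction {M : Type*} [MetricSpace M] (o x : M) : C(M, ℝ) :=
  ⟨fun y => dist x o - dist x y, by fun_prop⟩

/-- The horofunction compactification of `M`: the closure of the functions `ξ_x` in the topology of
uniform convergence on compact sets (the compact-open topology on `C(M, ℝ)`).
Its elements are the horofunctions on `M`. -/
def HorofunctionCompactification (M : Type*) [MetricSpace M] (o : M) : Type _ :=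
  {ξ : C(M, ℝ) // ξ ∈ closure (Set.range (pointHorofunction o))}

namespace HorofunctionCompactification

variable {M : Type*} [MetricSpace M] {o : M}

instance : TopologicalSpace (HorofunctionCompactification M o) :=
  instTopologicalSpaceSubtype

instance : MeasurableSpace (HorofunctionCompactification M o) :=
  borel _

instance : BorelSpace (HorofunctionCompactification M o) :=
  ⟨rfl⟩

instance : CoeFun (HorofunctionCompactification M o) (fun _ => M → ℝ) :=
  ⟨fun ξ => ξ.1⟩

/-- The element `ξ_x` of the horofunction compactification. -/
def ofPoint (o x : M) : HorofunctionCompactification M o :=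
  ⟨pointHorofunction o x, subset_closure (Set.mem_range_self x)⟩

end HorofunctionCompactification

/-- The sequence of random points `(x_n)` indexed by the integers is distance stationary: the
distribution of `(d(x_m, x_n))_{m,n}` is that of `(d(x_{m+1}, x_{n+1}))_{m,n}`. -/
def IsDistanceStationary {Ω M : Type*} [MeasurableSpace Ω] [MetricSpace M]
    (x : ℤ → Ω → M) (P : Measure Ω) : Prop :=
  IdentDistrib (fun ω (p : ℤ × ℤ) => dist (x p.1 ω) (x p.2 ω))
    (fun ω (p : ℤ × ℤ) => dist (x (p.1 + 1) ω) (x (p.2 + 1) ω)) P P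

/-- The real random sequence `(s_n)` indexed by the integers is stationary: it has the same
distribution as `(s_{n+1})`. -/
def IsStationarySequence {Ω : Type*} [MeasurableSpace Ω]
    (s : ℤ → Ω → ℝ) (P : Measure Ω) : Prop :=
  IdentDistrib (fun ω (n : ℤ) => s n ω) (fun ω (n : ℤ) => s (n + 1) ω) P P

/-- The linear drift (speed) `ℓ = lim d(x_0, x_n) / n`. (The value is meaningful where the limit
exists; that it exists almost surely has to be asserted separately.) -/
noncomputable def linearDrift {Ω M : Type*} [MetricSpace M] (x : ℤ → Ω → M) (ω : Ω) : ℝ :=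
  limUnder atTop (fun n : ℕ => dist (x 0 ω) (x (n : ℤ) ω) / (n : ℝ))

/-- The arithmetic mean `(1 / (k + 1)) ∑_{j = 0}^{k} ν_j` of the first `k + 1` terms of a sequence
of probability measures. -/
noncomputable def cesaroMean {X : Type*} [MeasurableSpace X] (ν : ℕ → ProbabilityMeasure X)
    (k : ℕ) : ProbabilityMeasure X :=
  ⟨((k : ℝ≥0∞) + 1)⁻¹ • ∑ j ∈ Finset.range (k + 1), (ν j : Measure X), ⟨by
    simp only [Measure.smul_apply, Measure.finsetSum_apply, measure_univ, Finset.sum_const,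
      Finset.card_range, nsmul_eq_mul, mul_one, Nat.cast_add, Nat.cast_one, smul_eq_mul]
    exact ENNReal.inv_mul_cancel (by positivity) (by finiteness)⟩⟩

/-- A sequence of probability measures is Cesàro convergent to `μ`: its arithmetic means converge
weakly to `μ`. -/
def CesaroConvergesTo {X : Type*} [MeasurableSpace X] [TopologicalSpace X]
    [OpensMeasurableSpace X] (ν : ℕ → ProbabilityMeasure X) (μ : ProbabilityMeasure X) : Prop :=
  Tendsto (cesaroMean ν) atTop (𝓝 μ)

/-- The random probability measure `(1 / n) ∑_{i = 1}^{n} δ_{ξ_{x_{-i}}}` on the horofunction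
compactification, where the argument `m` stands for `n = m + 1`. -/
noncomputable def pastMeasure {Ω M : Type*} [MetricSpace M] (o : M) (x : ℤ → Ω → M) (m : ℕ)
    (ω : Ω) : ProbabilityMeasure (HorofunctionCompactification M o) :=
  cesaroMean (fun i : ℕ =>
    diracProba (HorofunctionCompactification.ofPoint o (x (-((i : ℤ) + 1)) ω))) m

/-- The random measure `μ` is the conditional distribution of the random element `ξ` given the
σ-algebra `𝒢`: for each measurable `A`, almost surely `P(ξ ∈ A | 𝒢) = μ(A)`. -/
def IsCondDistribGiven {Ω X : Type*} (𝒢 : MeasurableSpace Ω) [mΩ : MeasurableSpace Ω]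
    [MeasurableSpace X] (ξ : Ω → X) (μ : Ω → ProbabilityMeasure X) (P : Measure Ω) : Prop :=
  ∀ A : Set X, MeasurableSet A →
    P⟦ξ ⁻¹' A | 𝒢⟧ =ᵐ[P] fun ω => (μ ω : Measure X).real A

/-! For the horofunction of a past point `x_{-i}`, the increment between `x_0` and `x_1` is
`d(x_{-i}, x_1) - d(x_{-i}, x_0)`: the base point cancels. With `a_n = E d(x_0, x_n)`, distance
stationarity gives it mean `a_{i+1} - a_i`, so averaging over the past telescopes to `a_n / n` up to
a vanishing error, and this converges by Fekete's lemma (`integral_increment_eq`). The same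
telescoping, applied to a bounded continuous test function of the whole increment sequence, shows
that a shift changes its averaged expectation by `O(1/n)`; in the limit the increments are
stationary (`isStationarySequence_increments`).

To pass to the limit, the weak convergence must hold for almost every sample point along one
deterministic subsequence, because the functionals involve the path and the horofunction jointly.
Compactness alone would give subsequences depending on the sample point. Komlós' theorem for a
countable dense family of test functions supplies the common subsequence
(`exists_strictMono_ae_cesaro_tendsto`), and dominated convergence does the rest
(`integral_eq_of_tendsto_average`).

Birkhoff's theorem now gives an almost sure limit `b` of the averaged increments, with `E b = lim
a_n / n`. Horofunctions are 1-Lipschitz, so the telescoped increments bound `d(x_0, x_n)` from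
below. From above, cut `[0, n]` into blocks of length `k`: Birkhoff's theorem for the `k`-th power
of the shift bounds the growth rate by `c_k / k`, of mean `a_k / k`. Since `c_k / k ≥ b` and the
means tend to `E b`, the infimum over `k` is `b` almost surely, and the two bounds meet
(`IsDistanceStationary.ae_tendsto_dist_div`). The horofunction thus replaces the subadditive ergodic
theorem: the existence of the drift is part of the outcome. -/

/-- The set of `1`-Lipschitz functions vanishing at `o` is compact in the compact-open topology. -/
theorem isCompact_lipschitz_vanishing {M : Type*} [MetricSpace M] (o : M) :
    IsCompact {ξ : C(M, ℝ) | (∀ y z, |ξ y - ξ z| ≤ dist y z) ∧ ξ o = 0} := by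
  apply ArzelaAscoli.isCompact_of_equicontinuous
  -- The pointwise image is closed in a product of compact intervals, because a pointwise
  -- 1-Lipschitz function is automatically continuous; no compactness of `M` enters.
  · have himage : ContinuousMap.toFun '' {ξ : C(M, ℝ) | (∀ y z, |ξ y - ξ z| ≤ dist y z) ∧ ξ o = 0} =
        {f : M → ℝ | (∀ y z, |f y - f z| ≤ dist y z) ∧ f o = 0} := by
      ext f
      constructor
      · rintro ⟨ξ, hξ, rfl⟩
        exact hξ
      · rintro ⟨hf, hf0⟩
        have hlip : LipschitzWith 1 f := LipschitzWith.of_dist_le_mul fun y z => by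
          simpa [Real.dist_eq] using hf y z
        exact ⟨⟨f, hlip.continuous⟩, ⟨hf, hf0⟩, rfl⟩
    rw [himage]
    refine (isCompact_univ_pi fun y : M =>
      isCompact_Icc (a := -dist y o) (b := dist y o)).of_isClosed_subset ?_ ?_
    · simp only [Set.ofPred_and, Set.ofPred_forall]
      exact (isClosed_iInter fun y => isClosed_iInter fun z =>
        isClosed_le (by fun_prop) continuous_const).inter
        (isClosed_eq (continuous_apply o) continuous_const)
    · rintro f ⟨hf, hf0⟩ y -
      have := hf y o
      rw [hf0, sub_zero] at this
      exact abs_le.mp this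
  · refine LipschitzWith.uniformEquicontinuous _ 1 (fun ξ => ?_) |>.equicontinuous
    exact LipschitzWith.of_dist_le_mul fun y z => by
      simpa [Real.dist_eq] using ξ.2.1 y z

/-! ### Topology of the horofunction space -/

namespace HorofunctionCompactification

variable {M : Type*} [MetricSpace M] {o : M}

theorem closure_subset_lipschitz : closure (Set.range (pointHorofunction o)) ⊆
    {ξ : C(M, ℝ) | (∀ y z, |ξ y - ξ z| ≤ dist y z) ∧ ξ o = 0} := by
  refine closure_minimal ?_ (isCompact_lipschitz_vanishing o).isClosed
  rintro _ ⟨x, rfl⟩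
  refine ⟨fun y z => ?_, by simp [pointHorofunction]⟩
  have h : dist x o - dist x y - (dist x o - dist x z) = dist x z - dist x y := by ring
  simp only [pointHorofunction, ContinuousMap.coe_mk, h]
  rw [dist_comm x z, dist_comm x y, dist_comm y z]
  exact abs_dist_sub_le z y x

theorem abs_sub_le (ξ : HorofunctionCompactification M o) (y z : M) :
    |ξ y - ξ z| ≤ dist y z :=
  (closure_subset_lipschitz ξ.2).1 y z

theorem ofPoint_apply (x y : M) : (ofPoint o x) y = dist x o - dist x y := rfl

instance : CompactSpace (HorofunctionCompactification M o) :=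
  isCompact_iff_compactSpace.mp
    ((isCompact_lipschitz_vanishing o).of_isClosed_subset isClosed_closure closure_subset_lipschitz)

instance : T2Space (HorofunctionCompactification M o) :=
  inferInstanceAs (T2Space {ξ : C(M, ℝ) // ξ ∈ closure (Set.range (pointHorofunction o))})

instance : Nonempty (HorofunctionCompactification M o) := ⟨ofPoint o o⟩

theorem continuous_apply_const (y : M) :
    Continuous fun ξ : HorofunctionCompactification M o => ξ y :=
  (continuous_eval_const (F := C(M, ℝ)) y).comp continuous_subtype_val

/-- The common Lipschitz constant makes evaluation jointly continuous although `M` need not be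
locally compact. -/
theorem continuous_uncurry_apply :
    Continuous fun p : HorofunctionCompactification M o × M => p.1 p.2 := by
  rw [continuous_iff_continuousAt]
  rintro ⟨ξ, y⟩
  have h1 : Tendsto (fun p : HorofunctionCompactification M o × M => p.1 y) (𝓝 (ξ, y))
      (𝓝 (ξ y)) := ((continuous_apply_const y).comp continuous_fst).continuousAt
  have h2 : Tendsto (fun p : HorofunctionCompactification M o × M => p.1 p.2 - p.1 y) (𝓝 (ξ, y))
      (𝓝 0) := by
    refine squeeze_zero_norm (a := fun p => dist p.2 y) (fun p => abs_sub_le p.1 p.2 y) ?_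
    have : Continuous fun p : HorofunctionCompactification M o × M => dist p.2 y := by fun_prop
    simpa using this.tendsto (ξ, y)
  simpa [ContinuousAt] using h1.add h2

theorem continuous_ofPoint : Continuous (ofPoint o : M → HorofunctionCompactification M o) := by
  refine Continuous.subtype_mk ?_ _
  refine ContinuousMap.continuous_of_continuous_uncurry _ ?_
  simp only [pointHorofunction, ContinuousMap.coe_mk, Function.uncurry_def]
  fun_prop

variable [TopologicalSpace.SeparableSpace M]

/-- Evaluation along a dense sequence is a continuous injection of a compact space into `ℕ → ℝ`,
hence an embedding. -/
instance : TopologicalSpace.MetrizableSpace (HorofunctionCompactification M o) := by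
  have : Nonempty M := ⟨o⟩
  let e : HorofunctionCompactification M o → ℕ → ℝ :=
    fun ξ n => ξ (TopologicalSpace.denseSeq M n)
  have he : Continuous e := continuous_pi fun n => continuous_apply_const _
  have hinj : Function.Injective e := fun ξ η h => by
    have hcoe : (ξ.1 : M → ℝ) = η.1 :=
      (TopologicalSpace.denseRange_denseSeq M).equalizer ξ.1.continuous η.1.continuous h
    exact Subtype.ext (DFunLike.coe_injective hcoe)
  exact (he.isClosedEmbedding hinj).isEmbedding.metrizableSpace

instance : SecondCountableTopology (HorofunctionCompactification M o) := by
  let _ := TopologicalSpace.metrizableSpaceMetric (HorofunctionCompactification M o)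
  infer_instance

instance : PolishSpace (HorofunctionCompactification M o) := by
  let _ := TopologicalSpace.metrizableSpaceMetric (HorofunctionCompactification M o)
  infer_instance

end HorofunctionCompactification

/-! ### Random probability measures and weak limits -/

section ProbabilityMeasure

variable {Ω X : Type*} [MeasurableSpace X]

theorem measurable_integral_probabilityMeasure [MeasurableSpace Ω]
    {μ : Ω → ProbabilityMeasure X} (hμ : Measurable μ) {f : X → ℝ} (hf : Measurable f) :
    Measurable fun ω => ∫ η, f η ∂(μ ω : Measure X) :=
  (StronglyMeasurable.integral_kernel
    (κ := (⟨fun ω => (μ ω : Measure X), measurable_subtype_coe.comp hμ⟩ : Kernel Ω X))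
    hf.stronglyMeasurable).measurable

/-- The random probability measure `μ` as a Markov kernel. -/
def randomMeasureKernel [MeasurableSpace Ω] (μ : Ω → ProbabilityMeasure X) (hμ : Measurable μ) :
    Kernel Ω X :=
  ⟨fun ω => (μ ω : Measure X), measurable_subtype_coe.comp hμ⟩

instance [MeasurableSpace Ω] (μ : Ω → ProbabilityMeasure X) (hμ : Measurable μ) :
    IsMarkovKernel (randomMeasureKernel μ hμ) :=
  ⟨fun ω => inferInstanceAs (IsProbabilityMeasure (μ ω : Measure X))⟩

theorem measurable_cesaroMean [MeasurableSpace Ω]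
    {ν : ℕ → Ω → ProbabilityMeasure X}
    (hν : ∀ j, Measurable (ν j)) (k : ℕ) : Measurable fun ω => cesaroMean (fun j => ν j ω) k := by
  refine Measurable.subtype_mk (Measure.measurable_of_measurable_coe _ fun A hA => ?_)
  simp only [Measure.smul_apply, Measure.finsetSum_apply, smul_eq_mul]
  refine (Finset.measurable_fun_sum _ fun j _ => ?_).const_mul _
  exact (Measure.measurable_coe hA).comp (measurable_subtype_coe.comp (hν j))

theorem integral_cesaroMean (ν : ℕ → ProbabilityMeasure X) (k : ℕ)
    {f : X → ℝ} (hf : ∀ j, Integrable f (ν j : Measure X)) :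
    ∫ η, f η ∂(cesaroMean ν k : Measure X) =
      (∑ j ∈ Finset.range (k + 1), ∫ η, f η ∂(ν j : Measure X)) / ((k : ℝ) + 1) := by
  change ∫ η, f η ∂(((k : ℝ≥0∞) + 1)⁻¹ • ∑ j ∈ Finset.range (k + 1), (ν j : Measure X)) = _
  rw [integral_smul_measure, integral_finsetSum_measure fun j _ => hf j]
  have : ((k : ℝ≥0∞) + 1)⁻¹.toReal = ((k : ℝ) + 1)⁻¹ := by
    rw [ENNReal.toReal_inv, ENNReal.toReal_add (by simp) (by simp)]
    simp
  rw [this, smul_eq_mul, div_eq_inv_mul]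

variable [TopologicalSpace X] [BorelSpace X]

/-- Indicators of closed sets are limits of bounded continuous functions, and closed sets form a
generating π-system. -/
theorem measurable_probabilityMeasure_of_integral [MeasurableSpace Ω] [HasOuterApproxClosed X]
    {μ : Ω → ProbabilityMeasure X}
    (h : ∀ f : BoundedContinuousFunction X ℝ, Measurable fun ω => ∫ η, f η ∂(μ ω : Measure X)) :
    Measurable μ := by
  suffices hm : Measurable fun ω => (μ ω : Measure X) from hm.subtype_mk
  refine Measurable.measure_of_isPiSystem_of_isProbabilityMeasure
    (S := {s | IsClosed s}) ?_ isPiSystem_isClosed ?_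
  · rw [← borel_eq_generateFrom_isClosed]
    exact BorelSpace.measurable_eq
  · intro F (hF : IsClosed F)
    refine measurable_of_tendsto_metrizable (f := fun n ω =>
      ∫⁻ η, (hF.apprSeq n η : ℝ≥0∞) ∂(μ ω : Measure X)) (fun n => ?_) ?_
    · have heq : (fun ω => ∫⁻ η, (hF.apprSeq n η : ℝ≥0∞) ∂(μ ω : Measure X)) =
          fun ω => ENNReal.ofReal (∫ η, ((hF.apprSeq n η : NNReal) : ℝ) ∂(μ ω : Measure X)) := by
        ext ω
        rw [← BoundedContinuousFunction.toReal_lintegral_coe_eq_integral, ENNReal.ofReal_toReal]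
        exact (BoundedContinuousFunction.lintegral_lt_top_of_nnreal _ _).ne
      rw [heq]
      refine (h ⟨⟨fun η => ((hF.apprSeq n η : NNReal) : ℝ), by fun_prop⟩, ?_⟩).ennreal_ofReal
      obtain ⟨C, hC⟩ := (hF.apprSeq n).map_bounded'
      exact ⟨C, hC⟩
    · rw [tendsto_pi_nhds]
      exact fun ω => HasOuterApproxClosed.tendsto_lintegral_apprSeq hF _

variable [CompactSpace X] [TopologicalSpace.MetrizableSpace X]

/-- Integration against a probability measure is 1-Lipschitz for the sup norm, so equality extends
from the dense sequence. -/
theorem probabilityMeasure_eq_of_integral_denseSeq {μ ν : ProbabilityMeasure X}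
    (h : ∀ m, ∫ η, TopologicalSpace.denseSeq C(X, ℝ) m η ∂(μ : Measure X) =
      ∫ η, TopologicalSpace.denseSeq C(X, ℝ) m η ∂(ν : Measure X)) : μ = ν := by
  have hcont (μ : ProbabilityMeasure X) : Continuous fun f : C(X, ℝ) =>
      ∫ η, f η ∂(μ : Measure X) := by
    refine LipschitzWith.continuous (K := 1) (LipschitzWith.of_dist_le_mul fun f g => ?_)
    have hint (f : C(X, ℝ)) : Integrable f (μ : Measure X) :=
      (BoundedContinuousFunction.mkOfCompact f).integrable μ.toMeasure
    rw [Real.dist_eq, ← integral_sub (hint f) (hint g), NNReal.coe_one, one_mul]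
    have hle : ∀ᵐ η ∂(μ : Measure X), ‖f η - g η‖ ≤ dist f g := Eventually.of_forall fun η => by
      rw [← dist_eq_norm]
      exact ContinuousMap.dist_apply_le_dist η
    have := norm_integral_le_of_norm_le_const hle
    simpa using this
  have heq := (TopologicalSpace.denseRange_denseSeq C(X, ℝ)).equalizer (hcont μ) (hcont ν)
    (funext h)
  have hmeas : (μ : Measure X) = ν := ext_of_forall_integral_eq_of_IsFiniteMeasure fun f =>
    congrFun heq f.toContinuousMap
  exact Subtype.ext hmeas

/-- Convergence of the integrals of countably many functions implies weak convergence. -/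
theorem exists_tendsto_of_integral_denseSeq {ν : ℕ → ProbabilityMeasure X}
    (h : ∀ m, ∃ l, Tendsto (fun k => ∫ η, TopologicalSpace.denseSeq C(X, ℝ) m η
      ∂(ν k : Measure X)) atTop (𝓝 l)) : ∃ μ, Tendsto ν atTop (𝓝 μ) := by
  choose l hl using h
  -- The prescribed limits determine every cluster point, so compactness leaves exactly one.
  have hcl (μ : ProbabilityMeasure X) (hμ : MapClusterPt μ atTop ν) (m : ℕ) :
      ∫ η, TopologicalSpace.denseSeq C(X, ℝ) m η ∂(μ : Measure X) = l m := by
    have hc := ProbabilityMeasure.continuous_integral_boundedContinuousFunction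
      (BoundedContinuousFunction.mkOfCompact (TopologicalSpace.denseSeq C(X, ℝ) m))
    have h1 := hμ.continuousAt_comp hc.continuousAt
    exact eq_of_nhds_neBot (ClusterPt.mono h1 (hl m))
  obtain ⟨μ, hμ⟩ := exists_clusterPt_of_compactSpace (map ν atTop)
  refine ⟨μ, tendsto_nhds_of_unique_mapClusterPt fun μ' hμ' => ?_⟩
  exact probabilityMeasure_eq_of_integral_denseSeq fun m => by rw [hcl μ' hμ', hcl μ hμ]

/-- The weak limit of a sequence of random probability measures can be chosen measurably. -/
theorem exists_measurable_weak_limit [MeasurableSpace Ω] [Nonempty X]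
    {ν : ℕ → Ω → ProbabilityMeasure X}
    (hν : ∀ k, Measurable (ν k)) : ∃ μ : Ω → ProbabilityMeasure X, Measurable μ ∧
      ∀ ω, (∃ μ', Tendsto (fun k => ν k ω) atTop (𝓝 μ')) →
        Tendsto (fun k => ν k ω) atTop (𝓝 (μ ω)) := by
  classical
  have hmeas (f : C(X, ℝ)) (k : ℕ) : Measurable fun ω => ∫ η, f η ∂(ν k ω : Measure X) :=
    measurable_integral_probabilityMeasure (hν k) f.continuous.measurable
  let C : Set Ω := {ω | ∃ μ', Tendsto (fun k => ν k ω) atTop (𝓝 μ')}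
  have hC : MeasurableSet C := by
    -- Convergence is tested on countably many functions, which makes the set of convergence
    -- measurable; off it the limit gets a constant default value.
    have : C = ⋂ m, {ω | ∃ l, Tendsto (fun k => ∫ η, TopologicalSpace.denseSeq C(X, ℝ) m η
        ∂(ν k ω : Measure X)) atTop (𝓝 l)} := by
      ext ω
      rw [Set.mem_iInter]
      refine ⟨fun ⟨μ', hμ'⟩ m => ?_, fun h => exists_tendsto_of_integral_denseSeq h⟩
      exact ⟨_, ProbabilityMeasure.tendsto_iff_forall_integral_tendsto.mp hμ'
        (BoundedContinuousFunction.mkOfCompact (TopologicalSpace.denseSeq C(X, ℝ) m))⟩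
    rw [this]
    exact MeasurableSet.iInter fun m => measurableSet_exists_tendsto fun k => hmeas _ k
  let μ : Ω → ProbabilityMeasure X := fun ω =>
    if h : ∃ μ', Tendsto (fun k => ν k ω) atTop (𝓝 μ') then h.choose
    else diracProba (Classical.arbitrary X)
  have hμ (ω : Ω) (h : ω ∈ C) : Tendsto (fun k => ν k ω) atTop (𝓝 (μ ω)) := by
    have : μ ω = Exists.choose h := dif_pos h
    rw [this]
    exact Exists.choose_spec h
  refine ⟨μ, measurable_probabilityMeasure_of_integral fun f => ?_, hμ⟩
  refine measurable_of_tendsto_metrizable (f := fun k => C.piecewise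
    (fun ω => ∫ η, f η ∂(ν k ω : Measure X)) (fun _ => f (Classical.arbitrary X)))
    (fun k => (hmeas f.toContinuousMap k).piecewise hC measurable_const) ?_
  rw [tendsto_pi_nhds]
  intro ω
  by_cases h : ω ∈ C
  · simp only [Set.piecewise_eq_of_mem _ _ _ h]
    exact ProbabilityMeasure.tendsto_iff_forall_integral_tendsto.mp (hμ ω h) f
  · simp only [Set.piecewise_eq_of_notMem _ _ _ h]
    have : μ ω = diracProba (Classical.arbitrary X) := dif_neg h
    rw [this]
    simp [diracProba]

end ProbabilityMeasure

/-! ### Birkhoff's ergodic theorem by a maximal argument -/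

section Birkhoff

variable {Y : Type*} {T : Y → Y}

/-- The maximum of `0` and the first `n` Birkhoff sums of `h`. -/
noncomputable def birkhoffMax (T : Y → Y) (h : Y → ℝ) : ℕ → Y → ℝ
  | 0, _ => 0
  | n + 1, y => max 0 (h y + birkhoffMax T h n (T y))

theorem birkhoffMax_nonneg (h : Y → ℝ) (n : ℕ) (y : Y) : 0 ≤ birkhoffMax T h n y := by
  cases n with
  | zero => exact le_rfl
  | succ n => exact le_max_left _ _

theorem birkhoffMax_le_succ (h : Y → ℝ) (n : ℕ) (y : Y) :
    birkhoffMax T h n y ≤ birkhoffMax T h (n + 1) y := by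
  induction n generalizing y with
  | zero => exact birkhoffMax_nonneg h 1 y
  | succ n ih => exact max_le_max le_rfl (by have := ih (T y); gcongr)

theorem monotone_birkhoffMax (h : Y → ℝ) (y : Y) : Monotone fun n => birkhoffMax T h n y :=
  monotone_nat_of_le_succ fun n => birkhoffMax_le_succ h n y

theorem birkhoffSum_le_birkhoffMax (h : Y → ℝ) (n : ℕ) (y : Y) :
    birkhoffSum T h n y ≤ birkhoffMax T h n y := by
  induction n generalizing y with
  | zero => simp [birkhoffMax]
  | succ n ih =>
    rw [birkhoffSum_succ']
    exact le_max_of_le_right (by have := ih (T y); gcongr)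

variable [MeasurableSpace Y] {ν : Measure Y}

theorem measurable_birkhoffMax (hT : Measurable T) {h : Y → ℝ} (hh : Measurable h) (n : ℕ) :
    Measurable (birkhoffMax T h n) := by
  induction n with
  | zero => exact measurable_const
  | succ n ih => exact measurable_const.max (hh.add (ih.comp hT))

theorem integrable_birkhoffMax (hT : MeasurePreserving T ν ν) {h : Y → ℝ}
    (hi : Integrable h ν) (n : ℕ) : Integrable (birkhoffMax T h n) ν := by
  induction n with
  | zero => exact integrable_zero _ _ _
  | succ n ih =>
    exact (integrable_zero _ _ _).sup (hi.add (hT.integrable_comp_of_integrable ih))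

/-- The set where the Birkhoff sums are unbounded above is invariant and carries nonnegative
integral. -/
theorem setIntegral_nonneg_of_unbounded_birkhoffMax
    (hT : MeasurePreserving T ν ν) {h : Y → ℝ} (hh : Measurable h) (hi : Integrable h ν) :
    let A : Set Y := {y | ¬ BddAbove (Set.range fun n => birkhoffMax T h n y)}
    MeasurableSet A ∧ T ⁻¹' A = A ∧ 0 ≤ ∫ y in A, h y ∂ν := by
  intro A
  have hA : MeasurableSet A :=
    (measurableSet_bddAbove_range fun n => measurable_birkhoffMax hT.measurable hh n).compl
  have hinv : T ⁻¹' A = A := by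
    ext y
    refine not_congr ⟨fun ⟨C, hC⟩ => ⟨max 0 (h y + C), ?_⟩, fun ⟨C, hC⟩ => ⟨C - h y, ?_⟩⟩
    · rintro _ ⟨n, rfl⟩
      refine (birkhoffMax_le_succ h n y).trans (max_le_max le_rfl ?_)
      have := hC ⟨n, rfl⟩
      simp only at this
      gcongr
    · rintro _ ⟨n, rfl⟩
      have h1 : birkhoffMax T h (n + 1) y ≤ C := hC ⟨n + 1, rfl⟩
      have h2 : h y + birkhoffMax T h n (T y) ≤ birkhoffMax T h (n + 1) y := le_max_right _ _
      simp only
      linarith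
  refine ⟨hA, hinv, ?_⟩
  have hG := fun n => integrable_birkhoffMax hT hi n
  have hGT (n : ℕ) : Integrable (fun y => birkhoffMax T h n (T y)) ν :=
    hT.integrable_comp_of_integrable (hG n)
  have hshift (n : ℕ) : ∫ y in A, birkhoffMax T h n (T y) ∂ν = ∫ y in A, birkhoffMax T h n y ∂ν := by
    have := setIntegral_map (μ := ν) (g := T) (s := A) hA (f := birkhoffMax T h n)
      (by rw [hT.map_eq]; exact (hG n).aestronglyMeasurable) hT.aemeasurable
    rw [hT.map_eq, hinv] at this
    exact this.symm
  -- With `G_n` the maximal sums, the integrand is `G_{n+1} - G_n ∘ T`; by invariance it has the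
  -- integral of `G_{n+1} - G_n ≥ 0` over `A`.
  have hnonneg (n : ℕ) : 0 ≤ ∫ y in A, max (h y) (-birkhoffMax T h n (T y)) ∂ν := by
    have heq : ∀ y, max (h y) (-birkhoffMax T h n (T y)) =
        birkhoffMax T h (n + 1) y - birkhoffMax T h n (T y) := by
      intro y
      rw [birkhoffMax, max_comm, ← max_sub_sub_right]
      simp
    simp_rw [heq]
    rw [integral_sub (hG _).integrableOn (hGT n).integrableOn, hshift, sub_nonneg]
    exact integral_mono (hG _).integrableOn (hG _).integrableOn fun y => birkhoffMax_le_succ h n y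
  -- On `A` one has `G_n(T y) → ∞`, so the maximum is eventually `h y`; since `G_n ≥ 0`, it is
  -- dominated by `|h|`.
  refine ge_of_tendsto' (x := atTop) ?_ hnonneg
  refine tendsto_integral_of_dominated_convergence (fun y => |h y|) (fun n => ?_)
    hi.abs.integrableOn (fun n => Eventually.of_forall fun y => ?_) ?_
  · exact (hh.max ((measurable_birkhoffMax hT.measurable hh n).comp
      hT.measurable).neg).aestronglyMeasurable
  · have := birkhoffMax_nonneg (T := T) h n (T y)
    rw [Real.norm_eq_abs, abs_le]
    exact ⟨le_max_of_le_left (neg_abs_le _), max_le (le_abs_self _) (by linarith [abs_nonneg (h y)])⟩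
  · filter_upwards [ae_restrict_mem hA] with y hy
    have hy' : T y ∈ A := by rw [← hinv] at hy; exact hy
    have := tendsto_atTop_atTop_of_monotone' (monotone_birkhoffMax h (T y)) hy'
    refine tendsto_const_nhds.congr' ?_
    filter_upwards [this.eventually_ge_atTop (-h y)] with n hn
    rw [max_eq_left (by linarith)]

variable [IsProbabilityMeasure ν]

/-- Take `h = f - g - ε/2` with `g` the conditional expectation. The set of unbounded sums of `h` is
invariant, so `f - g` integrates to zero there and `h` to `-ε/2` times its measure; nonnegativity
makes it null. Elsewhere the sums of `h` are at most some `C`, and the other `ε/2` absorbs `C/n`. -/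
theorem ae_eventually_birkhoffSum_le (hT : MeasurePreserving T ν ν) {f : Y → ℝ} (hf : Measurable f)
    (hi : Integrable f ν) {ε : ℝ} (hε : 0 < ε) :
    ∀ᵐ y ∂ν, ∀ᶠ n : ℕ in atTop, birkhoffSum T f n y / n ≤
      (ν[f | MeasurableSpace.invariants T]) y + ε := by
  have hle := MeasurableSpace.invariants_le T
  set g : Y → ℝ := ν[f | MeasurableSpace.invariants T] with hg
  have hgm : Measurable[MeasurableSpace.invariants T] g := stronglyMeasurable_condExp.measurable
  have hgT : g ∘ T = g := MeasurableSpace.comp_eq_of_measurable_invariants hgm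
  set h : Y → ℝ := fun y => f y - g y - ε / 2 with hh
  have hhm : Measurable h := (hf.sub (hgm.mono hle le_rfl)).sub_const _
  have hhi : Integrable h ν := (hi.sub integrable_condExp).sub (integrable_const _)
  obtain ⟨hA, hinv, hnonneg⟩ := setIntegral_nonneg_of_unbounded_birkhoffMax hT hhm hhi
  set A : Set Y := {y | ¬ BddAbove (Set.range fun n => birkhoffMax T h n y)}
  have hint : ∫ y in A, h y ∂ν = -(ε / 2 * ν.real A) := by
    have h1 : ∫ y in A, g y ∂ν = ∫ y in A, f y ∂ν := setIntegral_condExp hle hi ⟨hA, hinv⟩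
    simp only [hh]
    have hfg : Integrable (fun y => f y - g y) ν := hi.sub integrable_condExp
    rw [integral_sub hfg.integrableOn (integrable_const _),
      integral_sub hi.integrableOn integrable_condExp.integrableOn, h1]
    simp [mul_comm]
  have hA0 : ν A = 0 := by
    have : ν.real A = 0 := by
      have := measureReal_nonneg (μ := ν) (s := A)
      rw [hint] at hnonneg
      nlinarith
    rwa [measureReal_eq_zero_iff] at this
  filter_upwards [measure_eq_zero_iff_ae_notMem.mp hA0] with y hy
  obtain ⟨C, hC⟩ := not_not.mp hy
  have hsum (n : ℕ) : birkhoffSum T f n y ≤ n * (g y + ε / 2) + C := by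
    have h1 : birkhoffSum T h n y ≤ C := (birkhoffSum_le_birkhoffMax h n y).trans (hC ⟨n, rfl⟩)
    have h2 : birkhoffSum T h n y = birkhoffSum T f n y - n * (g y + ε / 2) := by
      have hiter (k : ℕ) : g (T^[k] y) = g y := by
        induction k with
        | zero => rfl
        | succ k ih => rw [Function.iterate_succ_apply', ← ih]; exact congrFun hgT _
      simp only [birkhoffSum, hh, hiter, Finset.sum_sub_distrib, Finset.sum_const,
        Finset.card_range, nsmul_eq_mul]
      ring
    linarith
  have hlim : Tendsto (fun n : ℕ => C / (n : ℝ)) atTop (𝓝 0) :=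
    tendsto_const_div_atTop_nhds_zero_nat C
  filter_upwards [hlim.eventually_le_const (half_pos hε), eventually_gt_atTop 0] with n hn hn0
  have hn0' : (0 : ℝ) < n := by exact_mod_cast hn0
  rw [div_le_iff₀ hn0'] at hn ⊢
  linarith [hsum n]

/-- **Birkhoff's pointwise ergodic theorem**. -/
theorem ae_tendsto_birkhoffSum_div (hT : MeasurePreserving T ν ν) {f : Y → ℝ} (hf : Measurable f)
    (hi : Integrable f ν) :
    ∀ᵐ y ∂ν, Tendsto (fun n : ℕ => birkhoffSum T f n y / n) atTop
      (𝓝 ((ν[f | MeasurableSpace.invariants T]) y)) := by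
  have h1 : ∀ᵐ y ∂ν, ∀ k : ℕ, ∀ᶠ n : ℕ in atTop, birkhoffSum T f n y / n ≤
      (ν[f | MeasurableSpace.invariants T]) y + 1 / ((k : ℝ) + 1) :=
    ae_all_iff.mpr fun k => ae_eventually_birkhoffSum_le hT hf hi Nat.one_div_pos_of_nat
  -- The lower bound is the upper bound for `-f`.
  have h2 : ∀ᵐ y ∂ν, ∀ k : ℕ, ∀ᶠ n : ℕ in atTop, birkhoffSum T (-f) n y / n ≤
      (ν[-f | MeasurableSpace.invariants T]) y + 1 / ((k : ℝ) + 1) :=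
    ae_all_iff.mpr fun k => ae_eventually_birkhoffSum_le hT hf.neg hi.neg Nat.one_div_pos_of_nat
  filter_upwards [h1, h2, condExp_neg f (MeasurableSpace.invariants T) (μ := ν)] with y hy1 hy2 hy3
  rw [Metric.tendsto_nhds]
  intro ε hε
  obtain ⟨k, hk⟩ := exists_nat_one_div_lt hε
  filter_upwards [hy1 k, hy2 k] with n hn1 hn2
  rw [hy3, Pi.neg_apply] at hn2
  have hneg : birkhoffSum T (-f) n y = -birkhoffSum T f n y := by
    simp [birkhoffSum]
  rw [hneg, neg_div] at hn2
  rw [Real.dist_eq, abs_lt]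
  constructor <;> linarith

/-- Birkhoff's theorem for an observable of a random element with stationary distribution. -/
theorem exists_ae_tendsto_birkhoffSum_div {Ω : Type*} [MeasurableSpace Ω] {P : Measure Ω}
    [IsProbabilityMeasure P] {X : Ω → Y} (hX : Measurable X)
    (hT : MeasurePreserving T (P.map X) (P.map X)) {f : Y → ℝ} (hf : Measurable f)
    (hi : Integrable (fun ω => f (X ω)) P) :
    ∃ b : Ω → ℝ, Measurable b ∧ Integrable b P ∧ ∫ ω, b ω ∂P = ∫ ω, f (X ω) ∂P ∧
      ∀ᵐ ω ∂P, Tendsto (fun n : ℕ => birkhoffSum T f n (X ω) / n) atTop (𝓝 (b ω)) := by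
  have : IsProbabilityMeasure (P.map X) := Measure.isProbabilityMeasure_map hX.aemeasurable
  have hi' : Integrable f (P.map X) :=
    (integrable_map_measure hf.aestronglyMeasurable hX.aemeasurable).mpr hi
  have hle := MeasurableSpace.invariants_le T
  have hm : Measurable ((P.map X)[f | MeasurableSpace.invariants T]) :=
    (stronglyMeasurable_condExp.mono hle).measurable
  refine ⟨fun ω => ((P.map X)[f | MeasurableSpace.invariants T]) (X ω), hm.comp hX, ?_, ?_, ?_⟩
  · exact (integrable_map_measure hm.aestronglyMeasurable hX.aemeasurable).mp integrable_condExp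
  · rw [← integral_map hX.aemeasurable hm.aestronglyMeasurable, integral_condExp hle,
      integral_map hX.aemeasurable hf.aestronglyMeasurable]
  · exact ae_of_ae_map hX.aemeasurable (ae_tendsto_birkhoffSum_div hT hf hi')

end Birkhoff

/-! ### Komlós' theorem for bounded sequences -/

section Komlos

open scoped InnerProductSpace

variable {H : Type*} [NormedAddCommGroup H] [InnerProductSpace ℝ H]

/-- Banach–Alaoglu in the dual, carried back by Riesz. A single ultrafilter serves all sequences at
once, without diagonal extraction. -/
theorem exists_weak_ultrafilter_limit [CompleteSpace H] {v : ℕ → H} {C : ℝ} (hv : ∀ n, ‖v n‖ ≤ C)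
    (U : Ultrafilter ℕ) : ∃ w : H, ∀ h : H, Tendsto (fun n => ⟪v n, h⟫_ℝ) U (𝓝 ⟪w, h⟫_ℝ) := by
  have hK := WeakDual.isCompact_closedBall (𝕜 := ℝ) (E := H) 0 C
  obtain ⟨L, -, hL⟩ := hK.ultrafilter_le_nhds'
    (U.map fun n => StrongDual.toWeakDual (InnerProductSpace.toDual ℝ H (v n)))
    (Ultrafilter.mem_map.mpr (Filter.Eventually.of_forall fun n => by simpa using hv n))
  refine ⟨(InnerProductSpace.toDual ℝ H).symm (WeakDual.toStrongDual L), fun h => ?_⟩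
  rw [InnerProductSpace.toDual_symm_apply]
  exact ((WeakDual.eval_continuous h).tendsto L).comp hL

/-- Almost orthogonal bounded vectors have partial sums of square norm at most linear. -/
theorem norm_sq_sum_le_of_almost_orthogonal {v : ℕ → H} {B : ℝ} (hB : ∀ n, ‖v n‖ ≤ B) {m : ℕ}
    (hv : ∀ i j, m ≤ i → i < j → |⟪v i, v j⟫_ℝ| ≤ (1 / 2) ^ i) (k : ℕ) :
    ‖∑ j ∈ Finset.range k, v j‖ ^ 2 ≤ (B ^ 2 + 2 * (m * B ^ 2 + 2)) * k := by
  have hB0 : 0 ≤ B := (norm_nonneg _).trans (hB 0)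
  -- Each `j` has at most `m` uncontrolled partners, costing `B ^ 2` each by Cauchy–Schwarz; the
  -- geometric series costs at most `2`.
  have hinner (i j : ℕ) (hij : i < j) :
      ⟪v i, v j⟫_ℝ ≤ (if i < m then B ^ 2 else 0) + (1 / 2 : ℝ) ^ i := by
    split_ifs with h
    · have h1 : ⟪v i, v j⟫_ℝ ≤ B * B := (real_inner_le_norm _ _).trans
        (mul_le_mul (hB i) (hB j) (norm_nonneg _) hB0)
      have h2 : (0 : ℝ) ≤ (1 / 2) ^ i := by positivity
      nlinarith
    · rw [zero_add]
      exact (le_abs_self _).trans (hv i j (not_lt.mp h) hij)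
  have hcross (j : ℕ) : ⟪∑ i ∈ Finset.range j, v i, v j⟫_ℝ ≤ m * B ^ 2 + 2 := by
    rw [sum_inner]
    refine (Finset.sum_le_sum fun i hi => hinner i j (Finset.mem_range.mp hi)).trans ?_
    rw [Finset.sum_add_distrib]
    gcongr
    · rw [← Finset.sum_filter, Finset.sum_const, nsmul_eq_mul]
      gcongr
      refine (Finset.card_le_card (t := Finset.range m) fun i hi => ?_).trans
        (Finset.card_range m).le
      simpa using (Finset.mem_filter.mp hi).2
    · exact (summable_geometric_two.sum_le_tsum _ fun i _ => by positivity).trans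
        tsum_geometric_two.le
  induction k with
  | zero => simp
  | succ k ih =>
    rw [Finset.sum_range_succ, norm_add_sq_real]
    have h1 := hcross k
    have h2 : ‖v k‖ ^ 2 ≤ B ^ 2 := pow_le_pow_left₀ (norm_nonneg _) (hB k) 2
    push_cast
    linarith

/-- Adding `C` makes the partial sums monotone, and consecutive squares have ratio tending to one,
so the averages between squares are squeezed. -/
theorem tendsto_average_of_tendsto_average_sq {g : ℕ → ℝ} {C l : ℝ} (hg : ∀ n, |g n| ≤ C)
    (h : Tendsto (fun N : ℕ => (∑ j ∈ Finset.range ((N + 1) ^ 2), g j) / ((N : ℝ) + 1) ^ 2) atTop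
      (𝓝 l)) :
    Tendsto (fun n : ℕ => (∑ j ∈ Finset.range n, g j) / (n : ℝ)) atTop (𝓝 l) := by
  have hmain : Tendsto (fun n : ℕ => (∑ j ∈ Finset.range n, (g j + C)) / (n : ℝ)) atTop
      (𝓝 (l + C)) := by
    refine tendsto_div_of_monotone_of_exists_subseq_tendsto_div _ _ ?_ fun a ha => ?_
    · refine monotone_nat_of_le_succ fun n => ?_
      rw [Finset.sum_range_succ]
      linarith [neg_le_of_abs_le (hg n)]
    · refine ⟨fun N => (N + 1) ^ 2, ?_, ?_, ?_⟩
      · have hlim : Tendsto (fun N : ℕ => (1 + 1 / ((N : ℝ) + 1)) ^ 2) atTop (𝓝 1) := by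
          simpa using (tendsto_one_div_add_atTop_nhds_zero_nat (𝕜 := ℝ)).const_add 1 |>.pow 2
        filter_upwards [hlim.eventually_le_const ha] with N hN
        have hpos : (0 : ℝ) < (N : ℝ) + 1 := by positivity
        have heq : ((((N + 1 + 1) ^ 2 : ℕ)) : ℝ) =
            (1 + 1 / ((N : ℝ) + 1)) ^ 2 * ((N : ℝ) + 1) ^ 2 := by
          push_cast
          field_simp
        rw [heq]
        push_cast
        gcongr
      · exact (tendsto_pow_atTop two_ne_zero).comp (tendsto_add_atTop_nat 1)
      · refine (h.add_const C).congr fun N => ?_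
        have hpos : ((N : ℝ) + 1) ^ 2 ≠ 0 := by positivity
        rw [Finset.sum_add_distrib]
        simp only [Finset.sum_const, Finset.card_range, nsmul_eq_mul]
        push_cast
        field_simp
  have h2 := hmain.sub_const C
  rw [add_sub_cancel_right] at h2
  refine h2.congr' ?_
  filter_upwards [eventually_gt_atTop 0] with n hn
  have hpos : (n : ℝ) ≠ 0 := by positivity
  rw [Finset.sum_add_distrib]
  simp only [Finset.sum_const, Finset.card_range, nsmul_eq_mul]
  field_simp
  ring

variable {Ω : Type*} [MeasurableSpace Ω] {P : Measure Ω}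

/-- By Tonelli the sum of the squares has finite expectation, so it is almost surely finite and its
terms vanish. -/
theorem ae_tendsto_zero_of_summable_norm_sq {f : ℕ → Lp ℝ 2 P}
    (h : Summable fun n => ‖f n‖ ^ 2) : ∀ᵐ ω ∂P, Tendsto (fun n => f n ω) atTop (𝓝 0) := by
  have hlin (n : ℕ) : ∫⁻ ω, ‖f n ω‖ₑ ^ 2 ∂P = ENNReal.ofReal (‖f n‖ ^ 2) := by
    have h1 := eLpNorm_nnreal_pow_eq_lintegral (μ := P) (f := f n) (p := 2) two_ne_zero
    have h2 : ‖f n‖ₑ = eLpNorm (f n) 2 P := Lp.enorm_def _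
    rw [ENNReal.ofReal_pow (norm_nonneg _), ofReal_norm, h2]
    simpa using h1.symm
  have hsum : ∫⁻ ω, ∑' n, ‖f n ω‖ₑ ^ 2 ∂P ≠ ∞ := by
    rw [lintegral_tsum fun n => ((Lp.aestronglyMeasurable (f n)).enorm.pow_const 2)]
    simp_rw [hlin]
    rw [← ENNReal.ofReal_tsum_of_nonneg (fun n => by positivity) h]
    exact ENNReal.ofReal_ne_top
  have hae := ae_lt_top' (AEMeasurable.tsum fun n =>
    ((Lp.aestronglyMeasurable (f n)).enorm.pow_const 2)) hsum
  filter_upwards [hae] with ω hω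
  have h0 := ENNReal.tendsto_atTop_zero_of_tsum_ne_top hω.ne
  have h1 := ((ENNReal.continuous_rpow_const (y := (1 / 2 : ℝ))).tendsto 0).comp h0
  rw [tendsto_zero_iff_enorm_tendsto_zero]
  have h2 : (0 : ℝ≥0∞) ^ (1 / 2 : ℝ) = 0 := by simp
  rw [h2] at h1
  refine h1.congr fun n => ?_
  simp only [Function.comp_apply]
  rw [← ENNReal.rpow_natCast, ← ENNReal.rpow_mul]
  norm_num

/-- **Komlós' theorem** for countably many uniformly bounded sequences of random variables, with a
common subsequence. -/
theorem exists_strictMono_ae_cesaro_tendsto [IsProbabilityMeasure P] {g : ℕ → ℕ → Ω → ℝ}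
    (hg : ∀ m n, Measurable (g m n)) {C : ℕ → ℝ} (hC : ∀ m n ω, |g m n ω| ≤ C m) :
    ∃ φ : ℕ → ℕ, StrictMono φ ∧ ∀ m, ∀ᵐ ω ∂P, ∃ l, Tendsto
      (fun k : ℕ => (∑ j ∈ Finset.range k, g m (φ j) ω) / (k : ℝ)) atTop (𝓝 l) := by
  have hmem (m n : ℕ) : MemLp (g m n) 2 P :=
    MemLp.of_bound (hg m n).aestronglyMeasurable (C m) (Eventually.of_forall (hC m n))
  let v : ℕ → ℕ → Lp ℝ 2 P := fun m n => (hmem m n).toLp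
  have hv (m n : ℕ) : ‖v m n‖ ≤ C m := by
    have hC0 : 0 ≤ C m := by
      obtain ⟨ω⟩ : Nonempty Ω := nonempty_of_isProbabilityMeasure P
      exact (abs_nonneg _).trans (hC m n ω)
    have := Lp.norm_le_of_ae_bound (f := v m n) hC0 (by
      filter_upwards [(hmem m n).coeFn_toLp] with ω hω
      rw [hω]
      exact hC m n ω)
    simpa [measureUnivNNReal] using this
  let U : Ultrafilter ℕ := hyperfilter ℕ
  choose w hw using fun m => exists_weak_ultrafilter_limit (hv m) U
  let d : ℕ → ℕ → Lp ℝ 2 P := fun m n => v m n - w m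
  have hd (m : ℕ) (h : Lp ℝ 2 P) : Tendsto (fun n => ⟪h, d m n⟫_ℝ) U (𝓝 0) := by
    have h1 := (hw m h).sub_const ⟪w m, h⟫_ℝ
    rw [sub_self] at h1
    refine h1.congr fun n => ?_
    rw [← inner_sub_left, real_inner_comm]
  -- Each new index meets finitely many conditions, all holding along `U`, since only the sequences
  -- `m ≤ a` are tested against `a`. For fixed `m` the first `m` terms may therefore escape control.
  obtain ⟨φ, -, hφ⟩ := exists_seq_of_forall_finset_exists (fun _ : ℕ => True)
    (fun a b => a < b ∧ ∀ m ≤ a, |⟪d m a, d m b⟫_ℝ| ≤ (1 / 2) ^ a) (fun s _ => by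
      have h1 : ∀ᶠ b in (U : Filter ℕ), ∀ a ∈ s, a < b ∧
          ∀ m ∈ Finset.range (a + 1), |⟪d m a, d m b⟫_ℝ| ≤ (1 / 2) ^ a := by
        refine (Finset.eventually_all s).mpr fun a _ => Eventually.and ?_ ?_
        · exact (eventually_gt_atTop a).filter_mono Nat.hyperfilter_le_atTop
        · refine (Finset.eventually_all _).mpr fun m _ => ?_
          have := (hd m (d m a)).abs
          rw [abs_zero] at this
          exact this.eventually_le_const (by positivity)
      obtain ⟨b, hb⟩ := h1.exists
      exact ⟨b, trivial, fun a ha => ⟨(hb a ha).1, fun m hm =>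
        (hb a ha).2 m (Finset.mem_range_succ_iff.mpr hm)⟩⟩)
  have hmono : StrictMono φ := fun i j hij => (hφ i j hij).1
  refine ⟨φ, hmono, fun m => ?_⟩
  set K : ℝ := (C m + ‖w m‖) ^ 2 + 2 * (m * (C m + ‖w m‖) ^ 2 + 2) with hK
  have hS (k : ℕ) : ‖∑ j ∈ Finset.range k, d m (φ j)‖ ^ 2 ≤ K * k := by
    refine norm_sq_sum_le_of_almost_orthogonal (fun n => ?_) (fun i j hi hij => ?_) k
    · exact (norm_sub_le _ _).trans (by gcongr; exact hv m _)
    · refine ((hφ i j hij).2 m (hi.trans (hmono.id_le i))).trans ?_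
      exact pow_le_pow_of_le_one (by norm_num) (by norm_num) (hmono.id_le i)
  -- The mean of `n` terms has square norm at most `K / n`, which is summable along `n = (N + 1) ^
  -- 2`.
  have hsummable : Summable fun N : ℕ =>
      ‖(1 / ((N : ℝ) + 1) ^ 2) • ∑ j ∈ Finset.range ((N + 1) ^ 2), d m (φ j)‖ ^ 2 := by
    have hs : Summable fun N : ℕ => K * (1 / ((N : ℝ) + 1) ^ 2) := by
      refine Summable.mul_left K ?_
      have := (summable_nat_add_iff 1).mpr (Real.summable_one_div_nat_pow.mpr one_lt_two)
      simpa using this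
    refine Summable.of_nonneg_of_le (fun N => by positivity) (fun N => ?_) hs
    have hpos : (0 : ℝ) < ((N : ℝ) + 1) ^ 2 := by positivity
    have h1 := hS ((N + 1) ^ 2)
    rw [norm_smul, mul_pow, Real.norm_of_nonneg (by positivity)]
    calc (1 / ((N : ℝ) + 1) ^ 2) ^ 2 * ‖∑ j ∈ Finset.range ((N + 1) ^ 2), d m (φ j)‖ ^ 2
        ≤ (1 / ((N : ℝ) + 1) ^ 2) ^ 2 * (K * ((N + 1) ^ 2 : ℕ)) := by gcongr
      _ = K * (1 / ((N : ℝ) + 1) ^ 2) := by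
        push_cast
        field_simp
  have hcoe (N : ℕ) : ∀ᵐ ω ∂P,
      ((1 / ((N : ℝ) + 1) ^ 2) • ∑ j ∈ Finset.range ((N + 1) ^ 2), d m (φ j) : Lp ℝ 2 P) ω =
      (1 / ((N : ℝ) + 1) ^ 2) * ∑ j ∈ Finset.range ((N + 1) ^ 2), (g m (φ j) ω - w m ω) := by
    have hterm : ∀ᵐ ω ∂P, ∀ j, d m (φ j) ω = g m (φ j) ω - w m ω := ae_all_iff.mpr fun j => by
      filter_upwards [Lp.coeFn_sub (v m (φ j)) (w m), (hmem m (φ j)).coeFn_toLp] with ω h1 h2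
      rw [h1, Pi.sub_apply, h2]
    filter_upwards [hterm, Lp.coeFn_smul (1 / ((N : ℝ) + 1) ^ 2)
      (∑ j ∈ Finset.range ((N + 1) ^ 2), d m (φ j)),
      Lp.coeFn_finsetSum (Finset.range ((N + 1) ^ 2)) fun j => d m (φ j)] with ω h1 h2 h3
    rw [h2, Pi.smul_apply, h3, smul_eq_mul, Finset.sum_apply]
    simp_rw [h1]
  filter_upwards [ae_tendsto_zero_of_summable_norm_sq hsummable, ae_all_iff.mpr hcoe] with ω h1 h2
  refine ⟨w m ω, tendsto_average_of_tendsto_average_sq (fun n => hC m (φ n) ω) ?_⟩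
  have h3 := (h1.congr h2).add_const (w m ω)
  rw [zero_add] at h3
  refine h3.congr fun N => ?_
  have hpos : ((N : ℝ) + 1) ^ 2 ≠ 0 := by positivity
  rw [Finset.sum_sub_distrib]
  simp only [Finset.sum_const, Finset.card_range, nsmul_eq_mul]
  push_cast
  field_simp
  ring

end Komlos

/-! ### Cesàro limits of the past measures -/

section PastMeasure

variable {M : Type*} [MetricSpace M] {o : M} {Ω : Type*}

theorem integrable_of_continuous_compactSpace {X : Type*} [TopologicalSpace X] [CompactSpace X]
    [MeasurableSpace X] [BorelSpace X] {f : X → ℝ} (hf : Continuous f) (μ : Measure X)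
    [IsFiniteMeasure μ] : Integrable f μ :=
  (BoundedContinuousFunction.mkOfCompact ⟨f, hf⟩).integrable μ

theorem integral_pastMeasure (x : ℤ → Ω → M) (m : ℕ) (ω : Ω)
    {f : HorofunctionCompactification M o → ℝ} (hf : Continuous f) :
    ∫ η, f η ∂(pastMeasure o x m ω : Measure (HorofunctionCompactification M o)) =
      (∑ i ∈ Finset.range (m + 1),
        f (HorofunctionCompactification.ofPoint o (x (-((i : ℤ) + 1)) ω))) / ((m : ℝ) + 1) := by
  rw [pastMeasure, integral_cesaroMean _ _ fun j => integrable_of_continuous_compactSpace hf _]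
  congr 1
  refine Finset.sum_congr rfl fun i _ => ?_
  exact integral_dirac' _ _ hf.measurable.stronglyMeasurable

theorem integral_cesaroMean_pastMeasure (x : ℤ → Ω → M) (φ : ℕ → ℕ) (k : ℕ) (ω : Ω)
    {f : HorofunctionCompactification M o → ℝ} (hf : Continuous f) :
    ∫ η, f η ∂(cesaroMean (fun j => pastMeasure o x (φ j) ω) k :
        Measure (HorofunctionCompactification M o)) =
      (∑ j ∈ Finset.range (k + 1), (∑ i ∈ Finset.range (φ j + 1),
        f (HorofunctionCompactification.ofPoint o (x (-((i : ℤ) + 1)) ω))) / ((φ j : ℝ) + 1)) /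
        ((k : ℝ) + 1) := by
  rw [integral_cesaroMean _ _ fun j => integrable_of_continuous_compactSpace hf _]
  simp_rw [integral_pastMeasure x _ ω hf]

variable [MeasurableSpace M] [BorelSpace M] [MeasurableSpace Ω] {x : ℤ → Ω → M}

theorem measurable_pastMeasure (hx : ∀ n, Measurable (x n)) (m : ℕ) :
    Measurable (pastMeasure o x m) := by
  refine measurable_cesaroMean (fun i => ?_) m
  suffices h : Measurable fun ω => Measure.dirac
      (HorofunctionCompactification.ofPoint o (x (-((i : ℤ) + 1)) ω)) from h.subtype_mk
  exact Measure.measurable_dirac.comp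
    (HorofunctionCompactification.continuous_ofPoint.measurable.comp (hx _))

variable [TopologicalSpace.SeparableSpace M] {P : Measure Ω}

/-- Komlós' theorem is applied to the integrals of a dense sequence of test functions; almost surely
all of these Cesàro means converge, which suffices for weak convergence. -/
theorem exists_subseq_pastMeasure_cesaroConvergesTo [IsProbabilityMeasure P]
    (hx : ∀ n, Measurable (x n)) :
    ∃ (φ : ℕ → ℕ) (μ : Ω → ProbabilityMeasure (HorofunctionCompactification M o)),
      StrictMono φ ∧ Measurable μ ∧
      ∀ᵐ ω ∂P, CesaroConvergesTo (fun j => pastMeasure o x (φ j) ω) (μ ω) := by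
  let X := HorofunctionCompactification M o
  let f : ℕ → C(X, ℝ) := TopologicalSpace.denseSeq C(X, ℝ)
  obtain ⟨φ, hφ, hlim⟩ := exists_strictMono_ae_cesaro_tendsto (P := P)
    (g := fun m n ω => ∫ η, f m η ∂(pastMeasure o x n ω : Measure X)) (C := fun m => ‖f m‖)
    (fun m n => measurable_integral_probabilityMeasure (measurable_pastMeasure hx n)
      (f m).continuous.measurable)
    (fun m n ω => by
      have := norm_integral_le_of_norm_le_const (μ := (pastMeasure o x n ω : Measure X))
        (Eventually.of_forall fun η => (f m).norm_coe_le_norm η)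
      simpa using this)
  obtain ⟨μ, hμ, hconv⟩ := exists_measurable_weak_limit
    (ν := fun k ω => cesaroMean (fun j => pastMeasure o x (φ j) ω) k)
    (fun k => measurable_cesaroMean (fun j => measurable_pastMeasure hx (φ j)) k)
  refine ⟨φ, μ, hφ, hμ, ?_⟩
  filter_upwards [ae_all_iff.mpr hlim] with ω hω
  refine hconv ω (exists_tendsto_of_integral_denseSeq fun m => ?_)
  obtain ⟨l, hl⟩ := hω m
  refine ⟨l, (hl.comp (tendsto_add_atTop_nat 1)).congr fun k => ?_⟩
  rw [integral_cesaroMean _ _ fun j =>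
    integrable_of_continuous_compactSpace (TopologicalSpace.denseSeq C(X, ℝ) m).continuous _]
  simp [f, X]

/-- The limit random measure is almost surely a measurable function of the sequence of points. -/
theorem exists_measurable_factor_of_cesaroConvergesTo {φ : ℕ → ℕ}
    {μ : Ω → ProbabilityMeasure (HorofunctionCompactification M o)}
    (hconv : ∀ᵐ ω ∂P, CesaroConvergesTo (fun j => pastMeasure o x (φ j) ω) (μ ω)) :
    ∃ G : (ℤ → M) → ProbabilityMeasure (HorofunctionCompactification M o), Measurable G ∧
      ∀ᵐ ω ∂P, μ ω = G fun n => x n ω := by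
  -- The coordinate process on path space has the same past measures at each sample path, so a
  -- measurable limit built there is a function of the path; uniqueness of limits identifies it with
  -- `μ`.
  let c : ℤ → (ℤ → M) → M := fun n z => z n
  have hc (m : ℕ) : Measurable (pastMeasure o c m) :=
    measurable_pastMeasure (fun n => measurable_pi_apply n) m
  obtain ⟨G, hG, hlim⟩ := exists_measurable_weak_limit
    (ν := fun k (y : ℤ → M) => cesaroMean (fun j => pastMeasure o c (φ j) y) k)
    (fun k => measurable_cesaroMean (fun j => hc (φ j)) k)
  refine ⟨G, hG, ?_⟩
  filter_upwards [hconv] with ω hω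
  exact tendsto_nhds_unique hω (hlim (fun n => x n ω) ⟨μ ω, hω⟩)

end PastMeasure

/-! ### Sampling from a random measure -/

section ConditionalDistribution

open unitInterval

variable {Ω X Y : Type*} [MeasurableSpace Ω] [MeasurableSpace X] [MeasurableSpace Y]
  {P : Measure Ω} [IsProbabilityMeasure P]

/-- Sampling from the random measure `G (y)` by means of independent uniform randomness. -/
theorem isCondDistribGiven_of_uniform {y : Ω → Y} (hy : Measurable y) {v : Ω → I}
    (hv : Measurable v) (hvlaw : P.map v = volume) (hindep : IndepFun v y P)
    {G : Y → ProbabilityMeasure X} (hG : Measurable G) {f : ProbabilityMeasure X → I → X}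
    (hf : Measurable (Function.uncurry f))
    (hflaw : ∀ ν, (volume : Measure I).map (f ν) = (ν : Measure X)) :
    IsCondDistribGiven (MeasurableSpace.comap y inferInstance) (fun ω => f (G (y ω)) (v ω))
      (fun ω => G (y ω)) P := by
  intro A hA
  have hm : MeasurableSpace.comap y inferInstance ≤ ‹MeasurableSpace Ω› := hy.comap_le
  have hξ : Measurable fun ω => f (G (y ω)) (v ω) := hf.comp ((hG.comp hy).prodMk hv)
  have hGA : Measurable fun z => (G z : Measure X) A :=
    (Measure.measurable_coe hA).comp (measurable_subtype_coe.comp hG)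
  have hint : Integrable (fun ω => (G (y ω) : Measure X).real A) P :=
    Integrable.of_bound (hGA.comp hy).ennreal_toReal.aestronglyMeasurable 1
      (Eventually.of_forall fun ω => by
        rw [Real.norm_of_nonneg measureReal_nonneg]
        exact measureReal_le_one)
  refine (ae_eq_condExp_of_forall_setIntegral_eq hm ?_ (fun s _ _ => hint.integrableOn) ?_ ?_).symm
  · exact (integrable_const 1).indicator (hξ hA)
  · rintro _ ⟨B, hB, rfl⟩ -
    rw [setIntegral_indicator (hξ hA)]
    simp only [integral_const, MeasurableSet.univ, measureReal_restrict_apply, Set.univ_inter,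
      smul_eq_mul, mul_one]
    have h1 : ∫ ω in y ⁻¹' B, (G (y ω) : Measure X).real A ∂P =
        (∫⁻ ω in y ⁻¹' B, (G (y ω) : Measure X) A ∂P).toReal :=
      integral_toReal (hGA.comp hy).aemeasurable (Eventually.of_forall fun ω => measure_lt_top _ _)
    rw [h1, measureReal_def]
    congr 1
    -- Independence gives `(v, y)` a product law; by Fubini the slice of `S` at `z ∈ B` has volume
    -- `G z A`.
    let S : Set (I × Y) := {p | p.2 ∈ B ∧ f (G p.2) p.1 ∈ A}
    have hS : MeasurableSet S := (measurable_snd hB).inter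
      ((hf.comp ((hG.comp measurable_snd).prodMk measurable_fst)) hA)
    have h2 : P (y ⁻¹' B ∩ (fun ω => f (G (y ω)) (v ω)) ⁻¹' A) =
        P.map (fun ω => (v ω, y ω)) S := by
      rw [Measure.map_apply (hv.prodMk hy) hS]
      rfl
    rw [h2, (indepFun_iff_map_prod_eq_prod_map_map hv.aemeasurable hy.aemeasurable).mp hindep,
      hvlaw, Measure.prod_apply_symm hS, ← setLIntegral_map hB hGA hy, ← lintegral_indicator hB]
    refine lintegral_congr fun z => ?_
    by_cases hz : z ∈ B
    · rw [Set.indicator_of_mem hz, ← hflaw (G z), Measure.map_apply (by fun_prop) hA]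
      congr 1
      ext t
      simp [S, hz]
    · rw [Set.indicator_of_notMem hz]
      have : (fun t => (t, z)) ⁻¹' S = ∅ := by
        ext t
        simp [S, hz]
      rw [this, measure_empty]
  · refine StronglyMeasurable.aestronglyMeasurable (Measurable.stronglyMeasurable ?_)
    exact hGA.ennreal_toReal.comp (comap_measurable y)

/-- One jointly measurable map `f` transports the uniform law to every probability measure.
Inserting `μ` itself gives measurability for `u` and `μ`; replacing `μ` by its almost sure version
`G (y)` lets the independence of `u` and `y` compute the conditional law. -/
theorem exists_isCondDistribGiven [StandardBorelSpace X] [Nonempty X] {y : Ω → Y}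
    (hy : Measurable y) {u : Ω → ℝ} (hu : Measurable u)
    (hunif : P.map u = volume.restrict (Set.Icc (0 : ℝ) 1)) (hindep : IndepFun u y P)
    {μ : Ω → ProbabilityMeasure X} {G : Y → ProbabilityMeasure X} (hG : Measurable G)
    (hμG : ∀ᵐ ω ∂P, μ ω = G (y ω)) :
    ∃ ξ : Ω → X, Measurable[MeasurableSpace.comap u inferInstance ⊔
        MeasurableSpace.comap μ inferInstance] ξ ∧
      IsCondDistribGiven (MeasurableSpace.comap y inferInstance) ξ μ P := by
  let κ : Kernel (ProbabilityMeasure X) X := randomMeasureKernel id measurable_id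
  obtain ⟨f, hf, hflaw⟩ := κ.exists_measurable_map_eq_unitInterval
  -- `u` lies in the unit interval only almost surely; projecting makes it `I`-valued with uniform
  -- law.
  let π : ℝ → I := Set.projIcc 0 1 zero_le_one
  have hπ : Measurable π := continuous_projIcc.measurable
  have hvlaw : P.map (fun ω => π (u ω)) = volume := by
    have hcoe : π ∘ ((↑) : I → ℝ) = id := funext fun t => Set.projIcc_val zero_le_one t
    calc P.map (fun ω => π (u ω)) = (P.map u).map π := (Measure.map_map hπ hu).symm
      _ = ((volume : Measure I).map (↑)).map π := by
        rw [hunif, unitInterval.measurePreserving_coe.map_eq]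
      _ = volume := by rw [Measure.map_map hπ measurable_subtype_coe, hcoe, Measure.map_id]
  have hcond := isCondDistribGiven_of_uniform hy (hπ.comp hu) hvlaw
    (hindep.comp hπ measurable_id) hG hf hflaw
  refine ⟨fun ω => f (μ ω) (π (u ω)), ?_, fun A hA => ?_⟩
  · have h1 : Measurable[MeasurableSpace.comap u inferInstance ⊔
        MeasurableSpace.comap μ inferInstance] μ :=
      (comap_measurable μ).mono le_sup_right le_rfl
    have h2 : Measurable[MeasurableSpace.comap u inferInstance ⊔
        MeasurableSpace.comap μ inferInstance] u :=
      (comap_measurable u).mono le_sup_left le_rfl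
    exact hf.comp (h1.prodMk (hπ.comp h2))
  · have hae : ∀ᵐ ω ∂P, f (μ ω) (π (u ω)) = f (G (y ω)) (π (u ω)) := by
      filter_upwards [hμG] with ω hω
      rw [hω]
    refine (condExp_congr_ae ?_).trans ((hcond A hA).trans ?_)
    · filter_upwards [hae] with ω hω
      have hiff : ω ∈ (fun ω => f (μ ω) (π (u ω))) ⁻¹' A ↔
          ω ∈ (fun ω => f (G (y ω)) (π (u ω))) ⁻¹' A := by
        rw [Set.mem_preimage, Set.mem_preimage, hω]
      exact Set.indicator_eq_indicator hiff rfl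
    · filter_upwards [hμG] with ω hω
      rw [hω]

/-- The joint law of `y` and of a random element with conditional distribution `μ` given `y`. -/
theorem map_prodMk_eq_map_compProd {y : Ω → Y} (hy : Measurable y) {ξ : Ω → X} (hξ : Measurable ξ)
    {μ : Ω → ProbabilityMeasure X} (hμ : Measurable μ)
    (hcond : IsCondDistribGiven (MeasurableSpace.comap y inferInstance) ξ μ P) :
    P.map (fun ω => (y ω, ξ ω)) =
      (P ⊗ₘ randomMeasureKernel μ hμ).map fun p => (y p.1, p.2) := by
  have hmap : Measurable fun p : Ω × X => (y p.1, p.2) :=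
    (hy.comp measurable_fst).prodMk measurable_snd
  have := Measure.isProbabilityMeasure_map (μ := P) (hy.prodMk hξ).aemeasurable
  refine Measure.ext_prod fun {B A} hB hA => ?_
  rw [Measure.map_apply (hy.prodMk hξ) (hB.prod hA), Measure.map_apply hmap (hB.prod hA)]
  have h1 : (fun p : Ω × X => (y p.1, p.2)) ⁻¹' B ×ˢ A = (y ⁻¹' B) ×ˢ A := rfl
  have h2 : (fun ω => (y ω, ξ ω)) ⁻¹' B ×ˢ A = y ⁻¹' B ∩ ξ ⁻¹' A := rfl
  rw [h1, h2, Measure.compProd_apply_prod (hy hB) hA]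
  have hμA : Measurable fun ω => (μ ω : Measure X) A :=
    (Measure.measurable_coe hA).comp (measurable_subtype_coe.comp hμ)
  change _ = ∫⁻ ω in y ⁻¹' B, (μ ω : Measure X) A ∂P
  have h3 : ∫ ω in y ⁻¹' B, (μ ω : Measure X).real A ∂P =
      (∫⁻ ω in y ⁻¹' B, (μ ω : Measure X) A ∂P).toReal :=
    integral_toReal hμA.aemeasurable (Eventually.of_forall fun ω => measure_lt_top _ _)
  have h4 : ∫⁻ ω in y ⁻¹' B, (μ ω : Measure X) A ∂P ≠ ∞ := by
    refine ((lintegral_mono fun ω => prob_le_one).trans_lt ?_).ne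
    simp
  rw [← ENNReal.toReal_eq_toReal_iff' (measure_ne_top _ _) h4, ← h3,
    ← setIntegral_congr_ae (g := fun ω => (μ ω : Measure X).real A) (hy hB)
      ((hcond A hA).mono fun ω h _ => h),
    setIntegral_condExp hy.comap_le ((integrable_const 1).indicator (hξ hA)) ⟨B, hB, rfl⟩,
    setIntegral_indicator (hξ hA)]
  simp [measureReal_def]

end ConditionalDistribution

/-! ### Arrays of distances and their shift -/

section DistanceStationary

variable {Ω M : Type*} [MeasurableSpace Ω] [MetricSpace M] {P : Measure Ω} {x : ℤ → Ω → M}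

/-- The array of distances of a sequence of random points. -/
def distArray (x : ℤ → Ω → M) (ω : Ω) (p : ℤ × ℤ) : ℝ :=
  dist (x p.1 ω) (x p.2 ω)

/-- The diagonal shift of arrays. -/
def shiftArray (D : ℤ × ℤ → ℝ) (p : ℤ × ℤ) : ℝ :=
  D (p.1 + 1, p.2 + 1)

theorem measurable_shiftArray : Measurable shiftArray :=
  measurable_pi_lambda _ fun _ => measurable_pi_apply _

theorem iterate_shiftArray (k : ℕ) (D : ℤ × ℤ → ℝ) (p : ℤ × ℤ) :
    shiftArray^[k] D p = D (p.1 + k, p.2 + k) := by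
  induction k generalizing D with
  | zero => simp
  | succ k ih =>
    rw [Function.iterate_succ_apply, ih, shiftArray]
    push_cast
    simp only [add_assoc]

theorem IsDistanceStationary.identDistrib_dist (hstat : IsDistanceStationary x P) (m n : ℤ) :
    IdentDistrib (fun ω => dist (x m ω) (x n ω)) (fun ω => dist (x (m + 1) ω) (x (n + 1) ω)) P P :=
  hstat.comp (measurable_pi_apply (m, n))

theorem IsDistanceStationary.integral_dist_add (hstat : IsDistanceStationary x P) (m : ℤ) (k : ℕ) :
    ∫ ω, dist (x m ω) (x (m + k) ω) ∂P = ∫ ω, dist (x 0 ω) (x (k : ℤ) ω) ∂P := by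
  have hstep (m : ℤ) : ∫ ω, dist (x m ω) (x (m + k) ω) ∂P =
      ∫ ω, dist (x (m + 1) ω) (x (m + 1 + k) ω) ∂P := by
    rw [(hstat.identDistrib_dist m (m + k)).integral_eq]
    simp only [add_right_comm]
  induction m using Int.induction_on with
  | zero => simp
  | succ i ih => rw [← hstep, ih]
  | pred i ih => rw [hstep, sub_add_cancel, ih]

theorem IsDistanceStationary.integral_shiftArray (hstat : IsDistanceStationary x P)
    {Ψ : (ℤ × ℤ → ℝ) → ℝ} (hΨ : Measurable Ψ) :
    ∫ ω, Ψ (shiftArray (distArray x ω)) ∂P = ∫ ω, Ψ (distArray x ω) ∂P :=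
  (hstat.comp hΨ).integral_eq.symm

theorem IsDistanceStationary.integrable_dist_succ (hstat : IsDistanceStationary x P)
    (hint : Integrable (fun ω => dist (x 0 ω) (x 1 ω)) P) (m : ℤ) :
    Integrable (fun ω => dist (x m ω) (x (m + 1) ω)) P := by
  induction m using Int.induction_on with
  | zero => simpa using hint
  | succ i ih => exact (hstat.identDistrib_dist _ _).integrable_iff.mp ih
  | pred i ih =>
    refine (hstat.identDistrib_dist _ _).integrable_iff.mpr ?_
    simpa using ih

variable [TopologicalSpace.SeparableSpace M] [MeasurableSpace M] [BorelSpace M]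

theorem measurable_dist_apply (hx : ∀ n, Measurable (x n)) (m n : ℤ) :
    Measurable fun ω => dist (x m ω) (x n ω) := by
  have := UniformSpace.secondCountable_of_separable M
  exact (hx m).dist (hx n)

theorem measurable_distArray (hx : ∀ n, Measurable (x n)) : Measurable (distArray x) :=
  measurable_pi_lambda _ fun p => measurable_dist_apply hx p.1 p.2

theorem IsDistanceStationary.integrable_dist_add (hstat : IsDistanceStationary x P)
    (hx : ∀ n, Measurable (x n)) (hint : Integrable (fun ω => dist (x 0 ω) (x 1 ω)) P)
    (m : ℤ) (k : ℕ) : Integrable (fun ω => dist (x m ω) (x (m + k) ω)) P := by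
  induction k with
  | zero => simp
  | succ k ih =>
    refine (ih.add (hstat.integrable_dist_succ hint (m + k))).mono'
      (measurable_dist_apply hx _ _).aestronglyMeasurable (Eventually.of_forall fun ω => ?_)
    rw [Real.norm_of_nonneg dist_nonneg]
    push_cast
    rw [← add_assoc]
    exact dist_triangle _ _ _

theorem IsDistanceStationary.measurePreserving_shiftArray (hstat : IsDistanceStationary x P)
    (hx : ∀ n, Measurable (x n)) :
    MeasurePreserving shiftArray (P.map (distArray x)) (P.map (distArray x)) := by
  refine ⟨measurable_shiftArray, ?_⟩
  rw [Measure.map_map measurable_shiftArray (measurable_distArray hx)]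
  exact hstat.map_eq.symm

end DistanceStationary

/-! ### Expectations under the sampled horofunction -/

section Expectation

variable {Ω M : Type*} [MeasurableSpace Ω] [MetricSpace M] {o : M} {P : Measure Ω}
  [IsProbabilityMeasure P] {x : ℤ → Ω → M} [MeasurableSpace M] [BorelSpace M]
  {φ : ℕ → ℕ} {μ : Ω → ProbabilityMeasure (HorofunctionCompactification M o)}
  {ξ : Ω → HorofunctionCompactification M o}

theorem tendsto_cesaro_div_succ {u : ℕ → ℝ} {l : ℝ} (h : Tendsto u atTop (𝓝 l)) :
    Tendsto (fun k : ℕ => (∑ j ∈ Finset.range (k + 1), u j) / ((k : ℝ) + 1)) atTop (𝓝 l) := by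
  refine (h.cesaro.comp (tendsto_add_atTop_nat 1)).congr fun k => ?_
  simp [div_eq_inv_mul]

/-- The expectation of a functional of the points and of a random horofunction sampled from the
limit measure, as a limit of averages over the points of the past. -/
theorem integral_eq_of_tendsto_average (hx : ∀ n, Measurable (x n)) (hφ : StrictMono φ)
    (hμ : Measurable μ)
    (hconv : ∀ᵐ ω ∂P, CesaroConvergesTo (fun j => pastMeasure o x (φ j) ω) (μ ω))
    (hξ : Measurable ξ)
    (hcond : IsCondDistribGiven (MeasurableSpace.comap (fun ω n => x n ω) MeasurableSpace.pi) ξ μ P)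
    {Φ : (ℤ → M) → HorofunctionCompactification M o → ℝ} (hΦ : Measurable (Function.uncurry Φ))
    (hcont : ∀ y, Continuous (Φ y)) {B : (ℤ → M) → ℝ} (hB : ∀ y η, |Φ y η| ≤ B y)
    (hBint : Integrable (fun ω => B fun n => x n ω) P) {l : ℝ}
    (hl : Tendsto (fun n : ℕ => (∑ i ∈ Finset.range (n + 1), ∫ ω, Φ (fun n => x n ω)
      (HorofunctionCompactification.ofPoint o (x (-((i : ℤ) + 1)) ω)) ∂P) / ((n : ℝ) + 1)) atTop
      (𝓝 l)) :
    ∫ ω, Φ (fun n => x n ω) (ξ ω) ∂P = l := by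
  have hy : Measurable fun ω n => x n ω := measurable_pi_lambda _ hx
  have hint {ζ : Ω → HorofunctionCompactification M o} (hζ : Measurable ζ) :
      Integrable (fun ω => Φ (fun n => x n ω) (ζ ω)) P :=
    hBint.mono' (hΦ.comp (hy.prodMk hζ)).aestronglyMeasurable
      (Eventually.of_forall fun ω => hB _ _)
  have hmap : Measurable fun p : Ω × HorofunctionCompactification M o =>
      ((fun n => x n p.1), p.2) := (hy.comp measurable_fst).prodMk measurable_snd
  have hlaw := map_prodMk_eq_map_compProd hy hξ hμ hcond
  have hjoint : ∫ ω, Φ (fun n => x n ω) (ξ ω) ∂P =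
      ∫ ω, ∫ η, Φ (fun n => x n ω) η ∂(μ ω : Measure _) ∂P := by
    have h1 : Integrable (fun p : Ω × HorofunctionCompactification M o =>
        Φ (fun n => x n p.1) p.2) (P ⊗ₘ randomMeasureKernel μ hμ) := by
      have h2 : Integrable (Function.uncurry Φ) (P.map fun ω => ((fun n => x n ω), ξ ω)) :=
        (integrable_map_measure hΦ.aestronglyMeasurable (hy.prodMk hξ).aemeasurable).mpr (hint hξ)
      rw [hlaw] at h2
      exact (integrable_map_measure hΦ.aestronglyMeasurable hmap.aemeasurable).mp h2
    calc ∫ ω, Φ (fun n => x n ω) (ξ ω) ∂P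
        = ∫ p, Function.uncurry Φ p ∂(P.map fun ω => ((fun n => x n ω), ξ ω)) :=
          (integral_map (hy.prodMk hξ).aemeasurable hΦ.aestronglyMeasurable).symm
      _ = ∫ p, Φ (fun n => x n p.1) p.2 ∂(P ⊗ₘ randomMeasureKernel μ hμ) := by
          rw [hlaw, integral_map hmap.aemeasurable hΦ.aestronglyMeasurable]
          rfl
      _ = _ := Measure.integral_compProd h1
  rw [hjoint]
  let ν : ℕ → Ω → ProbabilityMeasure (HorofunctionCompactification M o) := fun k ω =>
    cesaroMean (fun j => pastMeasure o x (φ j) ω) k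
  have hofPoint (i : ℕ) :
      Measurable fun ω => HorofunctionCompactification.ofPoint o (x (-((i : ℤ) + 1)) ω) :=
    HorofunctionCompactification.continuous_ofPoint.measurable.comp (hx _)
  have hν (k : ℕ) (ω : Ω) : ∫ η, Φ (fun n => x n ω) η ∂(ν k ω : Measure _) =
      (∑ j ∈ Finset.range (k + 1), (∑ i ∈ Finset.range (φ j + 1), Φ (fun n => x n ω)
        (HorofunctionCompactification.ofPoint o (x (-((i : ℤ) + 1)) ω))) / ((φ j : ℝ) + 1)) /
        ((k : ℝ) + 1) :=
    integral_cesaroMean_pastMeasure x φ k ω (hcont _)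
  have hlim : Tendsto (fun k => ∫ ω, ∫ η, Φ (fun n => x n ω) η ∂(ν k ω : Measure _) ∂P) atTop
      (𝓝 (∫ ω, ∫ η, Φ (fun n => x n ω) η ∂(μ ω : Measure _) ∂P)) := by
    refine tendsto_integral_of_dominated_convergence (fun ω => B fun n => x n ω) (fun k => ?_)
      hBint (fun k => Eventually.of_forall fun ω => ?_) ?_
    · simp_rw [hν]
      refine Measurable.aestronglyMeasurable ?_
      refine (Finset.measurable_fun_sum _ fun j _ => ?_).div_const _
      exact (Finset.measurable_fun_sum _ fun i _ =>
        hΦ.comp (hy.prodMk (hofPoint i))).div_const _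
    · have := norm_integral_le_of_norm_le_const (μ := (ν k ω : Measure _))
        (f := Φ fun n => x n ω) (Eventually.of_forall fun η => hB _ η)
      simpa using this
    · filter_upwards [hconv] with ω hω
      exact ProbabilityMeasure.tendsto_iff_forall_integral_tendsto.mp hω
        (BoundedContinuousFunction.mkOfCompact ⟨_, hcont fun n => x n ω⟩)
  -- By linearity the `k`-th expectation is a Cesàro mean of the averages in `hl` along `φ`, so it
  -- also tends to `l`.
  refine tendsto_nhds_unique hlim ?_
  refine (tendsto_cesaro_div_succ (hl.comp hφ.tendsto_atTop)).congr fun k => ?_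
  simp_rw [hν]
  rw [integral_div, integral_finsetSum _ fun j _ =>
    (integrable_finsetSum _ fun i _ => hint (hofPoint i)).div_const _]
  congr 1
  refine Finset.sum_congr rfl fun j _ => ?_
  rw [integral_div, integral_finsetSum _ fun i _ => hint (hofPoint i)]
  rfl

end Expectation

/-! ### Stationarity and mean of the increments -/

section Increments

variable {Ω M : Type*} [MeasurableSpace Ω] [MetricSpace M] {o : M} {P : Measure Ω}
  {x : ℤ → Ω → M} [TopologicalSpace.SeparableSpace M] [MeasurableSpace M] [BorelSpace M]
  {φ : ℕ → ℕ} {μ : Ω → ProbabilityMeasure (HorofunctionCompactification M o)}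
  {ξ : Ω → HorofunctionCompactification M o}

theorem HorofunctionCompactification.measurable_apply {Z : Type*} [MeasurableSpace Z]
    {ζ : Z → HorofunctionCompactification M o} {y : Z → M} (hζ : Measurable ζ)
    (hy : Measurable y) : Measurable fun z => ζ z (y z) :=
  HorofunctionCompactification.continuous_uncurry_apply.measurable.comp (hζ.prodMk hy)

theorem integrable_increment (hx : ∀ n, Measurable (x n))
    (hint : Integrable (fun ω => dist (x 0 ω) (x 1 ω)) P) (hξ : Measurable ξ) :
    Integrable (fun ω => ξ ω (x 0 ω) - ξ ω (x 1 ω)) P :=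
  hint.mono' ((HorofunctionCompactification.measurable_apply hξ (hx _)).sub
    (HorofunctionCompactification.measurable_apply hξ (hx _))).aestronglyMeasurable
    (Eventually.of_forall fun ω => (ξ ω).abs_sub_le _ _)

variable [IsProbabilityMeasure P]

/-- For a test function `G`, let `e i` be its expectation at the increments seen from `x_{-(i+1)}`.
Shifting those increments turns `e i` into `e (i + 1)`, so the differences telescope to a quantity
bounded by `2 * ‖G‖`, and their averages vanish. -/
theorem isStationarySequence_increments (hstat : IsDistanceStationary x P)
    (hx : ∀ n, Measurable (x n)) (hφ : StrictMono φ) (hμ : Measurable μ)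
    (hconv : ∀ᵐ ω ∂P, CesaroConvergesTo (fun j => pastMeasure o x (φ j) ω) (μ ω))
    (hξ : Measurable ξ)
    (hcond : IsCondDistribGiven (MeasurableSpace.comap (fun ω n => x n ω) MeasurableSpace.pi)
      ξ μ P) :
    IsStationarySequence (fun n ω => ξ ω (x n ω) - ξ ω (x (n + 1) ω)) P := by
  have hincm (k : ℤ) : Measurable fun ω (n : ℤ) => ξ ω (x (n + k) ω) - ξ ω (x (n + k + 1) ω) :=
    measurable_pi_lambda _ fun n =>
      (HorofunctionCompactification.measurable_apply hξ (hx _)).sub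
        (HorofunctionCompactification.measurable_apply hξ (hx _))
  have hinc0 : Measurable fun ω (n : ℤ) => ξ ω (x n ω) - ξ ω (x (n + 1) ω) := by
    simpa using hincm 0
  have hinc1 := hincm 1
  refine ⟨hinc0.aemeasurable, hinc1.aemeasurable, ?_⟩
  have := Measure.isProbabilityMeasure_map (μ := P) hinc0.aemeasurable
  have := Measure.isProbabilityMeasure_map (μ := P) hinc1.aemeasurable
  refine ext_of_forall_integral_eq_of_IsFiniteMeasure fun G => ?_
  have hGm : Measurable G := G.continuous.measurable
  rw [integral_map hinc0.aemeasurable hGm.aestronglyMeasurable,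
    integral_map hinc1.aemeasurable hGm.aestronglyMeasurable]
  let Φ : (ℤ → M) → HorofunctionCompactification M o → ℝ := fun y η =>
    G (fun n => η (y (n + 1)) - η (y (n + 1 + 1))) - G (fun n => η (y n) - η (y (n + 1)))
  have hint {ζ : Ω → ℤ → ℝ} (hζ : Measurable ζ) : Integrable (fun ω => G (ζ ω)) P :=
    Integrable.of_bound (hGm.comp hζ).aestronglyMeasurable ‖G‖
      (Eventually.of_forall fun ω => G.norm_coe_le_norm _)
  have heval (n : ℤ) : Measurable fun p : (ℤ → M) × HorofunctionCompactification M o =>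
      p.2 (p.1 n) :=
    HorofunctionCompactification.measurable_apply measurable_snd
      ((measurable_pi_apply n).comp measurable_fst)
  have hΦ : Measurable (Function.uncurry Φ) :=
    (hGm.comp (measurable_pi_lambda _ fun n => (heval _).sub (heval _))).sub
      (hGm.comp (measurable_pi_lambda _ fun n => (heval _).sub (heval _)))
  have hcont (y : ℤ → M) : Continuous (Φ y) := by
    have hc (n : ℤ) : Continuous fun η : HorofunctionCompactification M o => η (y n) :=
      HorofunctionCompactification.continuous_apply_const _
    exact (G.continuous.comp (continuous_pi fun n => (hc _).sub (hc _))).sub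
      (G.continuous.comp (continuous_pi fun n => (hc _).sub (hc _)))
  let e : ℕ → ℝ := fun i => ∫ ω, G (fun n => dist (x (-((i : ℤ) + 1)) ω) (x (n + 1) ω) -
    dist (x (-((i : ℤ) + 1)) ω) (x n ω)) ∂P
  have he (i : ℕ) : |e i| ≤ ‖G‖ := by
    have := norm_integral_le_of_norm_le_const (μ := P) (f := fun ω => G (fun n =>
      dist (x (-((i : ℤ) + 1)) ω) (x (n + 1) ω) - dist (x (-((i : ℤ) + 1)) ω) (x n ω)))
      (Eventually.of_forall fun ω => G.norm_coe_le_norm _)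
    rw [probReal_univ, mul_one] at this
    exact this
  have hdist (p : ℤ) (k : ℤ) : Measurable fun ω (n : ℤ) =>
      dist (x p ω) (x (n + k + 1) ω) - dist (x p ω) (x (n + k) ω) :=
    measurable_pi_lambda _ fun n =>
      (measurable_dist_apply hx _ _).sub (measurable_dist_apply hx _ _)
  have hD (i : ℕ) : ∫ ω, Φ (fun n => x n ω)
      (HorofunctionCompactification.ofPoint o (x (-((i : ℤ) + 1)) ω)) ∂P = e (i + 1) - e i := by
    -- A diagonal shift of the distance array moves the observer from `x_{-(i+2)}` to `x_{-(i+1)}`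
    -- and the increments one step forward.
    have hshift : e (i + 1) = ∫ ω, G (fun n => dist (x (-((i : ℤ) + 1)) ω) (x (n + 1 + 1) ω) -
        dist (x (-((i : ℤ) + 1)) ω) (x (n + 1) ω)) ∂P := by
      have hΨ : Measurable fun D : ℤ × ℤ → ℝ =>
          G fun n => D (-((i : ℤ) + 1 + 1), n + 1) - D (-((i : ℤ) + 1 + 1), n) :=
        hGm.comp (measurable_pi_lambda _ fun n =>
          (measurable_pi_apply _).sub (measurable_pi_apply _))
      have := hstat.integral_shiftArray hΨ
      simp only [shiftArray, distArray] at this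
      have hi : -((i : ℤ) + 1 + 1) + 1 = -((i : ℤ) + 1) := by ring
      rw [hi] at this
      simp only [e]
      push_cast
      exact this.symm
    rw [hshift, ← integral_sub (hint (hdist _ 1)) (hint (by simpa using hdist _ 0))]
    refine integral_congr_ae (Eventually.of_forall fun ω => ?_)
    simp only [Φ, HorofunctionCompactification.ofPoint_apply, sub_sub_sub_cancel_left]
  have hzero : ∫ ω, Φ (fun n => x n ω) (ξ ω) ∂P = 0 := by
    refine integral_eq_of_tendsto_average hx hφ hμ hconv hξ hcond hΦ hcont
      (B := fun _ => 2 * ‖G‖) (fun y η => ?_) (integrable_const _) ?_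
    · have h1 := G.norm_coe_le_norm fun n => η (y (n + 1)) - η (y (n + 1 + 1))
      have h2 := G.norm_coe_le_norm fun n => η (y n) - η (y (n + 1))
      rw [two_mul]
      exact (norm_sub_le _ _).trans (add_le_add h1 h2)
    · simp_rw [hD, Finset.sum_range_sub]
      have hb : Tendsto (fun n : ℕ => 2 * ‖G‖ / ((n : ℝ) + 1)) atTop (𝓝 0) := by
        have := (tendsto_one_div_add_atTop_nhds_zero_nat (𝕜 := ℝ)).const_mul (2 * ‖G‖)
        simp only [mul_one_div, mul_zero] at this
        exact this
      refine squeeze_zero_norm (fun n => ?_) hb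
      rw [norm_div, Real.norm_of_nonneg (by positivity : (0 : ℝ) ≤ (n : ℝ) + 1)]
      gcongr
      rw [two_mul]
      exact (norm_sub_le _ _).trans (add_le_add (he _) (he _))
  simp only [Φ] at hzero
  rw [integral_sub (hint hinc1) (hint hinc0)] at hzero
  exact (sub_eq_zero.mp hzero).symm

/-- The expected increment of a random horofunction sampled from the limit measure is the growth
rate of the expected distances. -/
theorem integral_increment_eq (hstat : IsDistanceStationary x P)
    (hint : Integrable (fun ω => dist (x 0 ω) (x 1 ω)) P)
    (hx : ∀ n, Measurable (x n)) (hφ : StrictMono φ) (hμ : Measurable μ)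
    (hconv : ∀ᵐ ω ∂P, CesaroConvergesTo (fun j => pastMeasure o x (φ j) ω) (μ ω))
    (hξ : Measurable ξ)
    (hcond : IsCondDistribGiven (MeasurableSpace.comap (fun ω n => x n ω) MeasurableSpace.pi)
      ξ μ P) {l : ℝ}
    (hl : Tendsto (fun n : ℕ => (∫ ω, dist (x 0 ω) (x (n : ℤ) ω) ∂P) / n) atTop (𝓝 l)) :
    ∫ ω, (ξ ω (x 0 ω) - ξ ω (x 1 ω)) ∂P = l := by
  have heval (n : ℤ) : Measurable fun p : (ℤ → M) × HorofunctionCompactification M o =>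
      p.2 (p.1 n) :=
    HorofunctionCompactification.measurable_apply measurable_snd
      ((measurable_pi_apply n).comp measurable_fst)
  refine integral_eq_of_tendsto_average (Φ := fun y η => η (y 0) - η (y 1)) hx hφ hμ hconv hξ hcond
    ((heval 0).sub (heval 1)) (fun y => ?_) (B := fun y => dist (y 0) (y 1))
    (fun y η => η.abs_sub_le _ _) hint ?_
  · exact (HorofunctionCompactification.continuous_apply_const _).sub
      (HorofunctionCompactification.continuous_apply_const _)
  · let a : ℕ → ℝ := fun n => ∫ ω, dist (x 0 ω) (x (n : ℤ) ω) ∂P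
    have hD (i : ℕ) : ∫ ω, (HorofunctionCompactification.ofPoint o (x (-((i : ℤ) + 1)) ω) (x 0 ω) -
        HorofunctionCompactification.ofPoint o (x (-((i : ℤ) + 1)) ω) (x 1 ω)) ∂P =
        a (i + 1 + 1) - a (i + 1) := by
      simp only [HorofunctionCompactification.ofPoint_apply, sub_sub_sub_cancel_left]
      have h1 : -((i : ℤ) + 1) + ((i + 1 : ℕ) : ℤ) = 0 := by push_cast; ring
      have h2 : -((i : ℤ) + 1) + ((i + 1 + 1 : ℕ) : ℤ) = 1 := by push_cast; ring
      have hi1 := hstat.integrable_dist_add hx hint (-((i : ℤ) + 1)) (i + 1)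
      have hi2 := hstat.integrable_dist_add hx hint (-((i : ℤ) + 1)) (i + 1 + 1)
      have he1 := hstat.integral_dist_add (-((i : ℤ) + 1)) (i + 1)
      have he2 := hstat.integral_dist_add (-((i : ℤ) + 1)) (i + 1 + 1)
      rw [h1] at hi1 he1
      rw [h2] at hi2 he2
      rw [integral_sub hi2 hi1, he1, he2]
    simp_rw [hD]
    simp_rw [Finset.sum_range_sub fun i => a (i + 1)]
    -- The telescoped average is `(a (n + 2) - a 1) / (n + 1)`; the factor `1 + 1 / (n + 1)`
    -- corrects the denominator `n + 2`.
    have h1 : Tendsto (fun n : ℕ => a (n + 2) / ((n : ℝ) + 2)) atTop (𝓝 l) := by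
      refine (hl.comp (tendsto_add_atTop_nat 2)).congr fun n => ?_
      simp [a]
    have h2 : Tendsto (fun n : ℕ => 1 / ((n : ℝ) + 1)) atTop (𝓝 0) :=
      tendsto_one_div_add_atTop_nhds_zero_nat
    have h3 := (h1.mul (h2.const_add 1)).sub (h2.const_mul (a 1))
    rw [add_zero, mul_one, mul_zero, sub_zero] at h3
    refine h3.congr fun n => ?_
    have hn1 : (n : ℝ) + 1 ≠ 0 := by positivity
    have hn2 : (n : ℝ) + 2 ≠ 0 := by positivity
    field_simp
    ring

end Increments

/-! ### Existence of the drift from block bounds -/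

section Drift

/-- Here `n / k` is integer division. `V n` and `V (k * (n / k))` grow at the same rate `v`, so the
incomplete block is `o(n)`. -/
theorem tendsto_block_sum_add_remainder_div {R V : ℕ → ℝ} {r v : ℝ} {k : ℕ} (hk : 0 < k)
    (hR : Tendsto (fun n : ℕ => R n / n) atTop (𝓝 r))
    (hV : Tendsto (fun n : ℕ => V n / n) atTop (𝓝 v)) :
    Tendsto (fun n : ℕ => (R (n / k) + (V n - V (k * (n / k)))) / n) atTop (𝓝 (r / k)) := by
  have hk' : (k : ℝ) ≠ 0 := by positivity
  have hdiv : Tendsto (fun n : ℕ => n / k) atTop atTop := Nat.tendsto_div_const_atTop hk.ne'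
  have hmul : Tendsto (fun n : ℕ => k * (n / k)) atTop atTop :=
    hdiv.const_mul_atTop' hk
  have hq : Tendsto (fun n : ℕ => ((n / k : ℕ) : ℝ) / n) atTop (𝓝 (1 / k)) := by
    have hrem : Tendsto (fun n : ℕ => ((n % k : ℕ) : ℝ) / n) atTop (𝓝 0) := by
      refine squeeze_zero (fun n => by positivity) (fun n => ?_)
        (tendsto_const_div_atTop_nhds_zero_nat (k : ℝ))
      gcongr
      exact (Nat.mod_lt n hk).le
    have h1 := (hrem.const_sub 1).div_const (k : ℝ)
    rw [sub_zero] at h1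
    refine h1.congr' ?_
    filter_upwards [eventually_gt_atTop 0] with n hn
    have hn' : (n : ℝ) ≠ 0 := by positivity
    have h2 : (k : ℝ) * ((n / k : ℕ) : ℝ) + ((n % k : ℕ) : ℝ) = n := by
      exact_mod_cast Nat.div_add_mod n k
    field_simp
    linarith
  have hlim := ((hR.comp hdiv).mul hq).add (hV.sub ((hV.comp hmul).mul (hq.const_mul (k : ℝ))))
  have heq : r * (1 / k) + (v - v * (k * (1 / k))) = r / k := by
    field_simp
    ring
  rw [heq] at hlim
  refine hlim.congr' ?_
  filter_upwards [eventually_gt_atTop 0, hdiv.eventually_gt_atTop 0] with n hn hnk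
  have hn' : (n : ℝ) ≠ 0 := by positivity
  have hnk' : ((n / k : ℕ) : ℝ) ≠ 0 := by positivity
  simp only [Function.comp_apply, Nat.cast_mul]
  field_simp

theorem dist_le_block_sum_add_remainder {M : Type*} [MetricSpace M] (y : ℕ → M) (k n : ℕ) :
    dist (y 0) (y n) ≤ ∑ i ∈ Finset.range (n / k), dist (y (k * i)) (y (k * (i + 1))) +
      (∑ i ∈ Finset.range n, dist (y i) (y (i + 1)) -
        ∑ i ∈ Finset.range (k * (n / k)), dist (y i) (y (i + 1))) := by
  have h1 := dist_le_range_sum_dist (fun i => y (k * i)) (n / k)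
  have h2 := dist_le_Ico_sum_dist y (Nat.mul_div_le n k)
  rw [Finset.sum_Ico_eq_sub _ (Nat.mul_div_le n k)] at h2
  simp only [mul_zero] at h1
  exact (dist_triangle _ _ _).trans (add_le_add h1 h2)

variable {Ω M : Type*} [MeasurableSpace Ω] [MetricSpace M] {o : M} {P : Measure Ω}
  {x : ℤ → Ω → M} [TopologicalSpace.SeparableSpace M]
  [MeasurableSpace M] [BorelSpace M]

/-- Fekete's lemma: the triangle inequality and stationarity make the expected distances
subadditive. -/
theorem IsDistanceStationary.exists_tendsto_integral_dist_div (hstat : IsDistanceStationary x P)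
    (hx : ∀ n, Measurable (x n)) (hint : Integrable (fun ω => dist (x 0 ω) (x 1 ω)) P) :
    ∃ l, Tendsto (fun n : ℕ => (∫ ω, dist (x 0 ω) (x (n : ℤ) ω) ∂P) / n) atTop (𝓝 l) := by
  have hi (m : ℤ) (k : ℕ) := hstat.integrable_dist_add hx hint m k
  have hsub : Subadditive fun n : ℕ => ∫ ω, dist (x 0 ω) (x (n : ℤ) ω) ∂P := by
    intro m n
    simp only
    rw [← hstat.integral_dist_add (m : ℤ) n, ← integral_add (by simpa using hi 0 m) (hi m n)]
    refine integral_mono (by simpa using hi 0 (m + n))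
      (Integrable.add (by simpa using hi 0 m) (hi m n)) fun ω => ?_
    push_cast
    exact dist_triangle _ _ _
  refine ⟨_, hsub.tendsto_lim ⟨0, ?_⟩⟩
  rintro _ ⟨n, rfl⟩
  exact div_nonneg (integral_nonneg fun ω => dist_nonneg) n.cast_nonneg

variable [IsProbabilityMeasure P]

/-- Birkhoff's theorem for the distances between the ends of consecutive blocks of length `k`. -/
theorem IsDistanceStationary.exists_ae_tendsto_block_sum_div (hstat : IsDistanceStationary x P)
    (hx : ∀ n, Measurable (x n)) (hint : Integrable (fun ω => dist (x 0 ω) (x 1 ω)) P) (k : ℕ) :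
    ∃ b : Ω → ℝ, Integrable b P ∧
      ∫ ω, b ω ∂P = ∫ ω, dist (x 0 ω) (x (k : ℤ) ω) ∂P ∧
      ∀ᵐ ω ∂P, Tendsto (fun n : ℕ => (∑ i ∈ Finset.range n,
        dist (x ((k * i : ℕ) : ℤ) ω) (x ((k * (i + 1) : ℕ) : ℤ) ω)) / n) atTop (𝓝 (b ω)) := by
  obtain ⟨b, -, hbi, hbint, hb⟩ := exists_ae_tendsto_birkhoffSum_div (measurable_distArray hx)
    ((hstat.measurePreserving_shiftArray hx).iterate k) (f := fun D => D (0, (k : ℤ)))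
    (measurable_pi_apply _) (by simpa [distArray] using hstat.integrable_dist_add hx hint 0 k)
  refine ⟨b, hbi, hbint, hb.mono fun ω hω => hω.congr fun n => ?_⟩
  congr 1
  refine Finset.sum_congr rfl fun i _ => ?_
  rw [← Function.iterate_mul]
  simp only [iterate_shiftArray, distArray]
  push_cast
  ring_nf

/-- If the distances from `x_0` are bounded below by a process growing almost surely at a linear
rate whose mean is the growth rate of the expected distances, then they grow at that same rate. -/
theorem IsDistanceStationary.ae_tendsto_dist_div (hstat : IsDistanceStationary x P)
    (hx : ∀ n, Measurable (x n)) (hint : Integrable (fun ω => dist (x 0 ω) (x 1 ω)) P) {b : Ω → ℝ}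
    (hb : Integrable b P)
    (hlim : Tendsto (fun n : ℕ => (∫ ω, dist (x 0 ω) (x (n : ℤ) ω) ∂P) / n) atTop
      (𝓝 (∫ ω, b ω ∂P)))
    {S : ℕ → Ω → ℝ} (hS : ∀ n ω, S n ω ≤ dist (x 0 ω) (x (n : ℤ) ω))
    (hSb : ∀ᵐ ω ∂P, Tendsto (fun n : ℕ => S n ω / n) atTop (𝓝 (b ω))) :
    ∀ᵐ ω ∂P, Tendsto (fun n : ℕ => dist (x 0 ω) (x (n : ℤ) ω) / (n : ℝ)) atTop (𝓝 (b ω)) := by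
  choose c hci hcint hc using hstat.exists_ae_tendsto_block_sum_div hx hint
  have hupper : ∀ᵐ ω ∂P, ∀ k : ℕ, ∃ U : ℕ → ℝ,
      (∀ n : ℕ, dist (x 0 ω) (x (n : ℤ) ω) / (n : ℝ) ≤ U n) ∧
      Tendsto U atTop (𝓝 (c (k + 1) ω / ((k + 1 : ℕ) : ℝ))) := by
    filter_upwards [ae_all_iff.mpr hc] with ω hω k
    -- Blocks of length one control the single steps in the remainder.
    have hV := hω 1
    simp only [one_mul] at hV
    refine ⟨_, fun n => ?_, tendsto_block_sum_add_remainder_div k.succ_pos (hω (k + 1)) hV⟩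
    gcongr
    exact dist_le_block_sum_add_remainder (fun i : ℕ => x (i : ℤ) ω) (k + 1) n
  have hlower : ∀ᵐ ω ∂P, ∀ k : ℕ, b ω ≤ c (k + 1) ω / ((k + 1 : ℕ) : ℝ) := by
    filter_upwards [hupper, hSb] with ω hω hb k
    obtain ⟨U, hU, hUlim⟩ := hω k
    refine le_of_tendsto_of_tendsto' hb hUlim fun n => ?_
    exact (div_le_div_of_nonneg_right (hS n ω) n.cast_nonneg).trans (hU n)
  have hclose : ∀ᵐ ω ∂P, ∀ j : ℕ, ∃ k : ℕ,
      c (k + 1) ω / ((k + 1 : ℕ) : ℝ) < b ω + 1 / ((j : ℝ) + 1) := by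
    refine ae_all_iff.mpr fun j => ?_
    have hε : (0 : ℝ) < 1 / ((j : ℝ) + 1) := Nat.one_div_pos_of_nat
    set ε : ℝ := 1 / ((j : ℝ) + 1)
    -- Markov's inequality for `c (k + 1) / (k + 1) - b ≥ 0`: on the exceptional set this is at
    -- least `ε` for every `k`, while its mean tends to zero.
    have hbound (k : ℕ) : P.real {ω | ¬ ∃ k : ℕ, c (k + 1) ω / ((k + 1 : ℕ) : ℝ) < b ω + ε} ≤
        ((∫ ω, dist (x 0 ω) (x ((k + 1 : ℕ) : ℤ) ω) ∂P) / ((k + 1 : ℕ) : ℝ) -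
          ∫ ω, b ω ∂P) / ε := by
      have hdiff : Integrable (fun ω => c (k + 1) ω / ((k + 1 : ℕ) : ℝ) - b ω) P :=
        ((hci _).div_const _).sub hb
      have h1 := mul_meas_ge_le_integral_of_nonneg (μ := P)
        (f := fun ω => c (k + 1) ω / ((k + 1 : ℕ) : ℝ) - b ω)
        (hlower.mono fun ω h => sub_nonneg.mpr (h k)) hdiff ε
      rw [integral_sub ((hci _).div_const _) hb, integral_div, hcint] at h1
      rw [le_div_iff₀' hε]
      refine (mul_le_mul_of_nonneg_left ?_ hε.le).trans h1
      refine measureReal_mono (fun ω hω => ?_) (measure_ne_top _ _)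
      have h2 : b ω + ε ≤ c (k + 1) ω / ((k + 1 : ℕ) : ℝ) :=
        not_lt.mp fun h => hω ⟨k, h⟩
      exact le_sub_iff_add_le'.mpr h2
    have hzero : Tendsto (fun k : ℕ =>
        ((∫ ω, dist (x 0 ω) (x ((k + 1 : ℕ) : ℤ) ω) ∂P) / ((k + 1 : ℕ) : ℝ) -
          ∫ ω, b ω ∂P) / ε) atTop (𝓝 0) := by
      have := ((hlim.comp (tendsto_add_atTop_nat 1)).sub_const (∫ ω, b ω ∂P)).div_const ε
      rw [sub_self, zero_div] at this
      exact this
    have hle := ge_of_tendsto' hzero hbound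
    have hnull := (measureReal_eq_zero_iff (measure_ne_top _ _)).mp
      (le_antisymm hle measureReal_nonneg)
    exact hnull
  filter_upwards [hupper, hclose, hSb] with ω hω hcω hbω
  rw [tendsto_order]
  refine ⟨fun a ha => ?_, fun a ha => ?_⟩
  · filter_upwards [hbω.eventually_const_lt ha] with n hn
    exact hn.trans_le (div_le_div_of_nonneg_right (hS n ω) n.cast_nonneg)
  · obtain ⟨j, hj⟩ := exists_nat_one_div_lt (sub_pos.mpr ha)
    obtain ⟨k, hk⟩ := hcω j
    obtain ⟨U, hU, hUlim⟩ := hω k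
    filter_upwards [hUlim.eventually_lt_const (hk.trans (lt_sub_iff_add_lt'.mp hj))] with n hn
    exact (hU n).trans_lt hn

variable {φ : ℕ → ℕ} {μ : Ω → ProbabilityMeasure (HorofunctionCompactification M o)}
  {ξ : Ω → HorofunctionCompactification M o}

/-- Birkhoff's theorem for the stationary increments provides the lower process required by
`IsDistanceStationary.ae_tendsto_dist_div`, with exactly the required mean. -/
theorem exists_drift_of_isCondDistribGiven (hstat : IsDistanceStationary x P)
    (hx : ∀ n, Measurable (x n)) (hint : Integrable (fun ω => dist (x 0 ω) (x 1 ω)) P)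
    (hφ : StrictMono φ) (hμ : Measurable μ)
    (hconv : ∀ᵐ ω ∂P, CesaroConvergesTo (fun j => pastMeasure o x (φ j) ω) (μ ω))
    (hξ : Measurable ξ)
    (hcond : IsCondDistribGiven (MeasurableSpace.comap (fun ω n => x n ω) MeasurableSpace.pi)
      ξ μ P) :
    ∃ b : Ω → ℝ, Integrable b P ∧ ∫ ω, b ω ∂P = ∫ ω, (ξ ω (x 0 ω) - ξ ω (x 1 ω)) ∂P ∧
      (∀ᵐ ω ∂P, Tendsto (fun n : ℕ => (∑ i ∈ Finset.range n,
        (ξ ω (x (i : ℤ) ω) - ξ ω (x ((i : ℤ) + 1) ω))) / (n : ℝ)) atTop (𝓝 (b ω))) ∧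
      ∀ᵐ ω ∂P, Tendsto (fun n : ℕ => dist (x 0 ω) (x (n : ℤ) ω) / (n : ℝ)) atTop (𝓝 (b ω)) := by
  obtain ⟨l, hl⟩ := hstat.exists_tendsto_integral_dist_div hx hint
  have hmean := integral_increment_eq hstat hint hx hφ hμ hconv hξ hcond hl
  have hstatinc := isStationarySequence_increments hstat hx hφ hμ hconv hξ hcond
  let s : Ω → ℤ → ℝ := fun ω n => ξ ω (x n ω) - ξ ω (x (n + 1) ω)
  have hs : Measurable s := measurable_pi_lambda _ fun n =>
    (HorofunctionCompactification.measurable_apply hξ (hx _)).sub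
      (HorofunctionCompactification.measurable_apply hξ (hx _))
  let T : (ℤ → ℝ) → ℤ → ℝ := fun D n => D (n + 1)
  have hT : Measurable T := measurable_pi_lambda _ fun n => measurable_pi_apply _
  have hTs : MeasurePreserving T (P.map s) (P.map s) :=
    ⟨hT, by rw [Measure.map_map hT hs]; exact hstatinc.map_eq.symm⟩
  have hiter (i : ℕ) (D : ℤ → ℝ) : T^[i] D 0 = D i := by
    have h (n : ℤ) : T^[i] D n = D (n + i) := by
      induction i generalizing D with
      | zero => simp
      | succ i ih =>
        rw [Function.iterate_succ_apply, ih]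
        simp only [T]
        push_cast
        rw [add_assoc]
    simpa using h 0
  obtain ⟨b, -, hbi, hbint, hb⟩ := exists_ae_tendsto_birkhoffSum_div hs hTs (f := fun D => D 0)
    (measurable_pi_apply _) (by simpa [s] using integrable_increment hx hint hξ)
  have hbsum : ∀ᵐ ω ∂P, Tendsto (fun n : ℕ => (∑ i ∈ Finset.range n,
      (ξ ω (x (i : ℤ) ω) - ξ ω (x ((i : ℤ) + 1) ω))) / (n : ℝ)) atTop (𝓝 (b ω)) := by
    refine hb.mono fun ω hω => hω.congr fun n => ?_
    simp only [birkhoffSum, hiter, s]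
  have hbint' : ∫ ω, b ω ∂P = ∫ ω, (ξ ω (x 0 ω) - ξ ω (x 1 ω)) ∂P := hbint
  refine ⟨b, hbi, hbint', hbsum, ?_⟩
  refine hstat.ae_tendsto_dist_div hx hint hbi (by rwa [hbint', hmean]) (fun n ω => ?_) hbsum
  -- The sum is `ξ (x 0) - ξ (x n)`, at most the distance because `ξ` is 1-Lipschitz.
  have htel := Finset.sum_range_sub' (fun i : ℕ => ξ ω (x (i : ℤ) ω)) n
  push_cast at htel
  rw [htel]
  exact (le_abs_self _).trans ((ξ ω).abs_sub_le _ _)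

end Drift

/-! ### The Furstenberg type formula -/

theorem theorem3p1 {M : Type*} [MetricSpace M] [CompleteSpace M]
    [TopologicalSpace.SeparableSpace M] [MeasurableSpace M] [BorelSpace M] (o : M)
    {Ω : Type*} [MeasurableSpace Ω] (P : Measure Ω) [IsProbabilityMeasure P]
    (x : ℤ → Ω → M) (hx : ∀ n, Measurable (x n))
    (hstat : IsDistanceStationary x P)
    (hint : Integrable (fun ω => dist (x 0 ω) (x 1 ω)) P)
    (u : Ω → ℝ) (hu : Measurable u)
    (hunif : P.map u = volume.restrict (Set.Icc (0 : ℝ) 1))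
    (hindep : IndepFun u (fun ω n => x n ω) P) :
    -- the linear drift exists almost surely as a limit and is integrable
    ((∀ᵐ ω ∂P, Tendsto (fun n : ℕ => dist (x 0 ω) (x (n : ℤ) ω) / (n : ℝ)) atTop
        (𝓝 (linearDrift x ω))) ∧
      Integrable (linearDrift x) P) ∧
    -- some subsequence of the past measures is almost surely Cesàro convergent
    (∃ (φ : ℕ → ℕ) (μ : Ω → ProbabilityMeasure (HorofunctionCompactification M o)),
      StrictMono φ ∧ Measurable μ ∧
      ∀ᵐ ω ∂P, CesaroConvergesTo (fun j => pastMeasure o x (φ j) ω) (μ ω)) ∧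
    -- for every such subsequence and limit:
    ∀ (φ : ℕ → ℕ) (μ : Ω → ProbabilityMeasure (HorofunctionCompactification M o)),
      StrictMono φ → Measurable μ →
      (∀ᵐ ω ∂P, CesaroConvergesTo (fun j => pastMeasure o x (φ j) ω) (μ ω)) →
      -- a random horofunction with conditional distribution `μ` exists
      (∃ ξ : Ω → HorofunctionCompactification M o,
        Measurable[MeasurableSpace.comap u inferInstance ⊔
          MeasurableSpace.comap μ inferInstance] ξ ∧
        IsCondDistribGiven (MeasurableSpace.comap (fun ω n => x n ω) MeasurableSpace.pi) ξ μ P) ∧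
      -- and every such random horofunction captures the linear drift by stationary increments
      ∀ ξ : Ω → HorofunctionCompactification M o,
        Measurable[MeasurableSpace.comap u inferInstance ⊔
          MeasurableSpace.comap μ inferInstance] ξ →
        IsCondDistribGiven (MeasurableSpace.comap (fun ω n => x n ω) MeasurableSpace.pi) ξ μ P →
        IsStationarySequence (fun n ω => ξ ω (x n ω) - ξ ω (x (n + 1) ω)) P ∧
        (∀ᵐ ω ∂P, Tendsto (fun n : ℕ => (∑ i ∈ Finset.range n,
            (ξ ω (x (i : ℤ) ω) - ξ ω (x ((i : ℤ) + 1) ω))) / (n : ℝ)) atTop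
          (𝓝 (linearDrift x ω))) ∧
        Integrable (fun ω => ξ ω (x 0 ω) - ξ ω (x 1 ω)) P ∧
        ∫ ω, linearDrift x ω ∂P = ∫ ω, (ξ ω (x 0 ω) - ξ ω (x 1 ω)) ∂P := by
  have hy : Measurable fun ω n => x n ω := measurable_pi_lambda _ hx
  have hexists (φ : ℕ → ℕ) (μ : Ω → ProbabilityMeasure (HorofunctionCompactification M o))
      (hconv : ∀ᵐ ω ∂P, CesaroConvergesTo (fun j => pastMeasure o x (φ j) ω) (μ ω)) :
      ∃ ξ : Ω → HorofunctionCompactification M o,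
        Measurable[MeasurableSpace.comap u inferInstance ⊔
          MeasurableSpace.comap μ inferInstance] ξ ∧
        IsCondDistribGiven (MeasurableSpace.comap (fun ω n => x n ω) MeasurableSpace.pi) ξ μ P := by
    obtain ⟨G, hG, hμG⟩ := exists_measurable_factor_of_cesaroConvergesTo hconv
    exact exists_isCondDistribGiven hy hu hunif hindep hG hμG
  have hmeas {μ : Ω → ProbabilityMeasure (HorofunctionCompactification M o)} (hμ : Measurable μ)
      {ξ : Ω → HorofunctionCompactification M o}
      (hξ : Measurable[MeasurableSpace.comap u inferInstance ⊔
        MeasurableSpace.comap μ inferInstance] ξ) : Measurable ξ :=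
    hξ.mono (sup_le hu.comap_le hμ.comap_le) le_rfl
  -- One auxiliary sampled horofunction already forces the drift to exist and be integrable.
  obtain ⟨φ₀, μ₀, hφ₀, hμ₀, hconv₀⟩ :=
    exists_subseq_pastMeasure_cesaroConvergesTo (o := o) (P := P) hx
  obtain ⟨ξ₀, hξ₀, hcond₀⟩ := hexists φ₀ μ₀ hconv₀
  obtain ⟨b₀, hb₀, -, -, hdist₀⟩ :=
    exists_drift_of_isCondDistribGiven hstat hx hint hφ₀ hμ₀ hconv₀ (hmeas hμ₀ hξ₀) hcond₀
  -- Uniqueness of limits identifies the Birkhoff limits of all choices of `φ`, `μ` and `ξ`,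
  -- although each is built from its own horofunction.
  have hdrift {b : Ω → ℝ} (hb : ∀ᵐ ω ∂P, Tendsto
      (fun n : ℕ => dist (x 0 ω) (x (n : ℤ) ω) / (n : ℝ)) atTop (𝓝 (b ω))) :
      b =ᵐ[P] linearDrift x := hb.mono fun ω hω => hω.limUnder_eq.symm
  refine ⟨⟨?_, hb₀.congr (hdrift hdist₀)⟩, ⟨φ₀, μ₀, hφ₀, hμ₀, hconv₀⟩, ?_⟩
  · filter_upwards [hdist₀, hdrift hdist₀] with ω h1 h2
    rwa [← h2]
  · intro φ μ hφ hμ hconv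
    refine ⟨hexists φ μ hconv, fun ξ hξ hcond => ?_⟩
    have hξm := hmeas hμ hξ
    obtain ⟨b, -, hbint, hbsum, hdist⟩ :=
      exists_drift_of_isCondDistribGiven hstat hx hint hφ hμ hconv hξm hcond
    refine ⟨isStationarySequence_increments hstat hx hφ hμ hconv hξm hcond, ?_,
      integrable_increment hx hint hξm, ?_⟩
    · filter_upwards [hbsum, hdrift hdist] with ω h1 h2
      rwa [← h2]
    · rw [← hbint]
      exact (integral_congr_ae (hdrift hdist)).symm
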